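/- All graphs are finite and simple. For a graph with nonnegative edge lengths, let $\mathsf{dist}$ denote its shortest-path distance. A minor of a graph is obtained by a finite sequence of edge contractions, edge deletions and vertex deletions, where a vertex created by contracting an edge keeps the name of one of the two ends of that edge. Let $G=(V,E,w)$ be a connected graph with edge lengths $w\ge 0$, and let $T\subseteq V$ be a set of $k$ vertices (the terminals). We say that the Steiner Point Removal problem for $(G,T)$ can be solved with distortion at most $\kappa$ if there are a minor $G'$ of $G$ with vertex set exactly $T$ and edge lengths $w'\ge 0$ on $G'$ such that $$\mathsf{dist}_G(s,t)\ \le\ \mathsf{dist}_{G'}(s,t)\ \le\ \kappa\cdot \mathsf{dist}_G(s,t)\qquad\text{for all } s,t\in T.$$ **Theorem.** There is an absolute constant $C$ such that, for every connected weighted graph $G$ and every set $T$ of $k$ terminals, the Steiner Point Removal problem can be solved with distortion at most $C\log^2 k$. Moreover, there is an absolute constant $k_0$ such that, whenever $k\ge k_0$, it can be solved with distortion at most $(2\times 10^8)\cdot\log^2 k$. Here $\log$ is the natural logarithm. -/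

import Mathlib

open scoped NNReal ENNReal

namespace SteinerPointRemoval

variable {V : Type*}

/-- The distance between `u` and `v` in the graph `G` whose edges have the nonnegative lengths `w`:
the infimum, over all walks from `u` to `v`, of the total length of the walk. It is `∞` if no walk
joins `u` and `v`. The values of `w` off the edges of `G` play no role. -/
noncomputable def wdist (G : SimpleGraph V) (w : Sym2 V → ℝ≥0) (u v : V) : ℝ≥0∞ :=
  ⨅ p : G.Walk u v, (((p.edges.map w).sum : ℝ≥0) : ℝ≥0∞)

/-- A graph whose vertex set is some subset of `V`: a subgraph of the complete graph on `V`. -/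
abbrev GraphIn (V : Type*) : Type _ := (⊤ : SimpleGraph V).Subgraph

open Classical in
/-- The contraction of the pair `u`, `v`: the vertex `v` is merged into `u`, the merged vertex keeps
the name `u`, and the loops and parallel edges that arise are discarded. -/
noncomputable def contract (H : GraphIn V) (u v : V) : GraphIn V where
  verts := Function.update id v u '' H.verts
  Adj a b := a ≠ b ∧ ∃ x y, H.Adj x y ∧ Function.update id v u x = a ∧ Function.update id v u y = b
  adj_sub h := h.1
  edge_vert := by
    rintro a b ⟨_, x, y, hxy, hx, _⟩
    exact ⟨x, H.edge_vert hxy, hx⟩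
  symm := ⟨by
    rintro a b ⟨hab, x, y, hxy, hx, hy⟩
    exact ⟨hab.symm, y, x, hxy.symm, hy, hx⟩⟩

/-- One minor operation: deleting a vertex, deleting an edge, or contracting an edge (the merged
vertex may keep the name of either end, as the two ends of the edge play symmetric roles). -/
inductive MinorStep : GraphIn V → GraphIn V → Prop
  | deleteVertex (H : GraphIn V) (v : V) (hv : v ∈ H.verts) : MinorStep H (H.deleteVerts {v})
  | deleteEdge (H : GraphIn V) (e : Sym2 V) (he : e ∈ H.edgeSet) : MinorStep H (H.deleteEdges {e})
  | contractEdge (H : GraphIn V) (u v : V) (huv : H.Adj u v) : MinorStep H (contract H u v)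

/-- `H` is a minor of `G`: it arises from `G` by a finite sequence of minor operations. -/
def IsMinor (H : GraphIn V) (G : SimpleGraph V) : Prop :=
  Relation.ReflTransGen MinorStep (SimpleGraph.toSubgraph G le_top) H

/-- The Steiner point removal problem for the graph `G` with edge lengths `w` and the set `T` of
terminals can be solved with distortion at most `κ`: some minor of `G` with vertex set exactly `T`,
with suitable nonnegative edge lengths `w'`, satisfies
`dist_G(s,t) ≤ dist_H(s,t) ≤ κ * dist_G(s,t)` for all terminals `s`, `t`. -/
def SolvableWithDistortion (G : SimpleGraph V) (w : Sym2 V → ℝ≥0) (T : Finset V) (κ : ℝ) : Prop :=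
  ∃ H : GraphIn V, IsMinor H G ∧ H.verts = (T : Set V) ∧
    ∃ w' : Sym2 H.verts → ℝ≥0, ∀ s t : H.verts,
      wdist G w s t ≤ wdist H.coe w' s t ∧
      wdist H.coe w' s t ≤ ENNReal.ofReal κ * wdist G w s t

end SteinerPointRemoval

/-! Assign every vertex to a terminal so that each cluster is connected and contains its terminal,
contract the clusters, and give each edge of the minor the `G`-distance of its ends. Distances
cannot shrink, so only the upper bound needs work.

Let `D` be the distance to the terminals. Terminals are processed one at a time: `t` takes the
unassigned vertices reachable from it through unassigned `b` with `d b t ≤ r * D b`, where `r = (1 +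
δ) ^ g` and `g` is thought of as geometric, truncated at `m`. With `δ = 1 / m`, `r` stays below 3.

Cut a geodesic between two terminals into blocks that are short compared with `D`; a slice is a
maximal run of unassigned positions in a block, weighted by `D` at the first vertex of the block. A
new cluster replaces everything between its first and last captured position by a detour through its
terminal, charged to one captured position `v`. Let `g₀` be the least exponent at which anything is
captured. Any larger exponent captures the whole slice of `v`, by `mem_cluster_of_run`. So the
potential, detours plus twice slices, rises by at most `3W` at `g₀` and falls by at least `W` beyond
it, where `W` is the weight at `v`. Since `g₀` has conditional probability 1/32, the exponential of
the potential, scaled by the length of the geodesic, does not grow on average, up to a truncation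
error.

No probability space is needed: for each terminal an exponent is picked at which the sum of these
exponentials over all pairs of terminals is at most its average (`exists_advance`,
`exists_clustering`). At the end the detours of each pair weigh `O(log k)` times its distance, and
`Tracks.chain_le` turns this into a bound in the minor. The resulting distortion is linear in `log
k`, stronger than required. -/

namespace SteinerPointRemoval

/-! ### Contracting connected fibres gives a minor. -/

section ImageGraph

universe u
variable {V : Type u}

/-- The graph obtained from `G` by identifying the vertices with the same image under `f`; the
resulting vertex is named by this image. -/
def imageGraph (G : SimpleGraph V) (f : V → V) : GraphIn V where
  verts := Set.range f
  Adj a b := a ≠ b ∧ ∃ x y, G.Adj x y ∧ f x = a ∧ f y = b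
  adj_sub h := h.1
  edge_vert := by
    rintro a b ⟨_, x, y, _, hx, _⟩
    exact ⟨x, hx⟩
  symm := ⟨by
    rintro a b ⟨hab, x, y, hxy, hx, hy⟩
    exact ⟨hab.symm, y, x, hxy.symm, hy, hx⟩⟩

theorem imageGraph_id (G : SimpleGraph V) :
    imageGraph G id = SimpleGraph.toSubgraph G le_top := by
  ext a b
  · simp [imageGraph]
  · simp only [imageGraph, SimpleGraph.toSubgraph]
    constructor
    · rintro ⟨_, x, y, h, rfl, rfl⟩; exact h
    · intro h; exact ⟨h.ne, a, b, h, rfl, rfl⟩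

open Classical in
theorem contract_imageGraph (G : SimpleGraph V) (h : V → V) (u v : V) :
    contract (imageGraph G h) u v = imageGraph G (Function.update id v u ∘ h) := by
  ext a b
  · simp [contract, imageGraph, Set.range_comp]
  · simp only [contract, imageGraph, Function.comp]
    constructor
    · rintro ⟨hab, _, _, ⟨_, x, y, hxy, rfl, rfl⟩, hx, hy⟩
      exact ⟨hab, x, y, hxy, hx, hy⟩
    · rintro ⟨hab, x, y, hxy, rfl, rfl⟩
      exact ⟨hab, _, _, ⟨fun hh => hab (by rw [hh]), x, y, hxy, rfl, rfl⟩, rfl, rfl⟩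

theorem reflTransGen_exists_step {α : Type*} {r : α → α → Prop} {P : α → Prop} {a b : α}
    (h : Relation.ReflTransGen r a b) (ha : P a) (hb : ¬ P b) :
    ∃ y z, P y ∧ ¬ P z ∧ r y z := by
  induction h with
  | refl => exact absurd ha hb
  | @tail y z _ hyz ih =>
    by_cases hP : P y
    · exact ⟨y, z, hP, hb, hyz⟩
    · exact ih hP

/-- If the fibres of the idempotent map `f` are connected, then contracting them yields a minor. -/
theorem isMinor_imageGraph [Finite V] (G : SimpleGraph V) (f : V → V) (hff : ∀ x, f (f x) = f x)
    (hconn : ∀ x, Relation.ReflTransGen (fun a b => G.Adj a b ∧ f b = f x) (f x) x) :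
    IsMinor (imageGraph G f) G := by
  classical
  have := Fintype.ofFinite V
  suffices H : ∀ (n : ℕ) (h : V → V), (Finset.univ.filter fun x => h x ≠ f x).card = n →
      (∀ x, f (h x) = f x) → (∀ x, h (f x) = f x) →
      Relation.ReflTransGen MinorStep (imageGraph G h) (imageGraph G f) by
    have := H _ id rfl (fun _ => rfl) (fun _ => rfl)
    rwa [imageGraph_id] at this
  intro n
  induction n using Nat.strong_induction_on with
  | _ n ih =>
    intro h hn hfh hhf
    by_cases hall : ∀ x, h x = f x
    · rw [show h = f from funext hall]
    push Not at hall
    obtain ⟨x, hx⟩ := hall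
    -- `h` records the contractions made so far. A path inside the fibre from `f x` to `x` must
    -- leave the vertices already merged into `f x`; the edge where it leaves is contracted next.
    obtain ⟨y, z, hy, hz, hyz, hfz⟩ := reflTransGen_exists_step (P := fun y => h y = f x)
      (hconn x) (hhf x) hx
    have hadj : (imageGraph G h).Adj (f x) (h z) := ⟨fun hh => hz hh.symm, y, z, hyz, hy, rfl⟩
    refine Relation.ReflTransGen.head (MinorStep.contractEdge _ _ _ hadj) ?_
    rw [contract_imageGraph]
    -- The name `h z` that disappears is not a final representative, so no finished vertex is
    -- disturbed and `z` is gained.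
    have hnf : ∀ w, f w ≠ h z := fun w hw => hz (by
      rw [← hw, ← hff w, hw, hfh, hfz])
    refine ih _ ?_ _ rfl ?_ ?_
    · rw [← hn]
      apply Finset.card_lt_card
      refine Finset.ssubset_iff_of_subset ?_ |>.2 ⟨z, ?_, ?_⟩
      · intro w
        simp only [Finset.mem_filter, Finset.mem_univ, true_and, Function.comp]
        intro hw hh
        rw [hh, Function.update_of_ne (hnf w)] at hw
        exact hw rfl
      · simpa [hfz] using hz
      · simp [hfz]
    · intro w
      simp only [Function.comp]
      by_cases hw : h w = h z
      · rw [hw, Function.update_self, hff, ← hfz, ← hfh z, ← hw, hfh]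
      · rw [Function.update_of_ne hw, id, hfh]
    · intro w
      simp only [Function.comp]
      rw [hhf, Function.update_of_ne (hnf w), id]

end ImageGraph

/-! ### A truncated geometric average -/

/-- The expectation of `y g`, where `g` is geometric with parameter `1/32`, truncated at `m`. -/
noncomputable def geomAvg : ℕ → (ℕ → ℝ) → ℝ
  | 0, y => y 0
  | m + 1, y => 1 / 32 * y 0 + 31 / 32 * geomAvg m (fun g => y (g + 1))

/-- The derandomisation step: some outcome is no worse than the average. -/
theorem exists_le_geomAvg (m : ℕ) (y : ℕ → ℝ) : ∃ g ≤ m, y g ≤ geomAvg m y := by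
  induction m generalizing y with
  | zero => exact ⟨0, le_rfl, le_rfl⟩
  | succ m ih =>
    obtain ⟨g, hg, h⟩ := ih (fun g => y (g + 1))
    by_cases h0 : y 0 ≤ geomAvg (m + 1) y
    · exact ⟨0, by omega, h0⟩
    · refine ⟨g + 1, by omega, ?_⟩
      simp only [geomAvg, not_le] at h0 h ⊢
      linarith

theorem geomAvg_sum {ι : Type*} (s : Finset ι) (m : ℕ) (y : ι → ℕ → ℝ) :
    geomAvg m (fun g => ∑ i ∈ s, y i g) = ∑ i ∈ s, geomAvg m (y i) := by
  induction m generalizing y with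
  | zero => rfl
  | succ m ih => simp only [geomAvg, ih (fun i g => y i (g + 1)), Finset.sum_add_distrib,
      Finset.mul_sum]

theorem geomAvg_le_const (m : ℕ) (y : ℕ → ℝ) (c : ℝ) (h : ∀ g, y g ≤ c) : geomAvg m y ≤ c := by
  induction m generalizing y with
  | zero => exact h 0
  | succ m ih =>
    have h1 := ih (fun g => y (g + 1)) fun g => h _
    have h2 := h 0
    simp only [geomAvg]
    linarith

/-- Convexity bounds both exponentials by chords over `0 ≤ x ≤ 1`, so only `x = 1` needs numerics.
This inequality dictates the parameter 1/32. -/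
theorem exp_average_le_one {x : ℝ} (h0 : 0 ≤ x) (h1 : x ≤ 1) :
    1 / 32 * Real.exp (3 * x) + 31 / 32 * Real.exp (-x) ≤ 1 := by
  have c := convexOn_exp.2
  have h3 := c (Set.mem_univ 0) (Set.mem_univ 3) (sub_nonneg.2 h1) h0 (by ring)
  have hm := c (Set.mem_univ 0) (Set.mem_univ (-1)) (sub_nonneg.2 h1) h0 (by ring)
  simp only [smul_eq_mul, mul_zero, zero_add, Real.exp_zero, mul_one, mul_neg] at h3 hm
  have e3 : Real.exp 3 ≤ 20.5 := by
    have : Real.exp 3 = Real.exp 1 ^ 3 := by rw [← Real.exp_nat_mul]; norm_num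
    rw [this]
    calc Real.exp 1 ^ 3 ≤ 2.72 ^ 3 := by
          gcongr; exact Real.exp_one_lt_d9.le.trans (by norm_num)
      _ ≤ 20.5 := by norm_num
  have em : Real.exp (-1) ≤ 0.3704 := by
    rw [Real.exp_neg]
    calc (Real.exp 1)⁻¹ ≤ (2.7 : ℝ)⁻¹ := by
          gcongr; exact le_trans (by norm_num) Real.exp_one_gt_d9.le
      _ ≤ 0.3704 := by norm_num
  rw [mul_comm 3 x]
  nlinarith

/-- By memorylessness one may shift until `g₀ = 0`, where `exp_average_le_one` applies. It fails
only if truncation strikes at `g₀` itself, an event of mass `(31/32) ^ m` and cost at most `exp 3`.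
-/
theorem geomAvg_le (m g₀ : ℕ) (y : ℕ → ℝ) (c x : ℝ) (hc : 0 ≤ c) (h0 : 0 ≤ x) (h1 : x ≤ 1)
    (hlt : ∀ g < g₀, y g ≤ c) (heq : y g₀ ≤ c * Real.exp (3 * x))
    (hgt : ∀ g, g₀ < g → y g ≤ c * Real.exp (-x)) :
    geomAvg m y ≤ (1 + Real.exp 3 * (31 / 32) ^ m) * c := by
  have e3 : Real.exp (3 * x) ≤ Real.exp 3 := Real.exp_le_exp.2 (by linarith)
  induction m generalizing y g₀ with
  | zero =>
    simp only [geomAvg, pow_zero, mul_one]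
    rcases Nat.eq_zero_or_pos g₀ with rfl | h
    · nlinarith
    · nlinarith [hlt 0 h, Real.exp_pos 3]
  | succ m ih =>
    simp only [geomAvg]
    rcases Nat.eq_zero_or_pos g₀ with rfl | h
    · have h2 := geomAvg_le_const m (fun g => y (g + 1)) _ fun g => hgt (g + 1) (by omega)
      have h3 := mul_le_mul_of_nonneg_left (exp_average_le_one h0 h1) hc
      have : 0 ≤ Real.exp 3 * (31 / 32 : ℝ) ^ (m + 1) * c := by positivity
      linarith
    · obtain ⟨g₁, rfl⟩ := Nat.exists_eq_add_of_lt h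
      have h2 := ih (g₀ := g₁) (fun g => y (g + 1)) (fun g hg => hlt _ (by omega))
        (by simpa using heq) fun g hg => hgt _ (by omega)
      have h3 := hlt 0 h
      rw [pow_succ]
      linarith

/-! ### Slices of a set of active positions -/

/-- The positions in `A` at which a slice begins: a slice is a maximal run of consecutive elements
of `A` which contains no block boundary, except possibly at its beginning. -/
noncomputable def starts (B : ℕ → Prop) (A : Finset ℕ) : Finset ℕ :=
  open Classical in A.filter fun i => B i ∨ i - 1 ∉ A

/-- The positions from `u` to `v` lie in a common slice of `A`. -/
def Run (B : ℕ → Prop) (A : Finset ℕ) (u v : ℕ) : Prop :=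
  ∀ i, u ≤ i → i ≤ v → i ∈ A ∧ (u < i → ¬ B i)

/-- The total weight of the slices of `A`. -/
noncomputable def sliceWeight (B : ℕ → Prop) (W : ℕ → ℝ) (A : Finset ℕ) : ℝ :=
  ∑ i ∈ starts B A, W i

theorem Run.eq_of_const {B : ℕ → Prop} {α : Type*} {W : ℕ → α}
    (hW : ∀ i, ¬ B (i + 1) → W (i + 1) = W i) {A : Finset ℕ} {u v : ℕ} (huv : u ≤ v)
    (h : Run B A u v) : W u = W v := by
  induction v, huv using Nat.le_induction with
  | base => rfl
  | succ v huv ih =>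
    rw [ih fun i h1 h2 => h i h1 (by omega), hW v ((h (v + 1) (by omega) le_rfl).2 (by omega))]

theorem Run.mono {B : ℕ → Prop} {A : Finset ℕ} {u v u' v' : ℕ} (h : Run B A u v)
    (hu : u ≤ u') (hv : v' ≤ v) : Run B A u' v' :=
  fun i h1 h2 => ⟨(h i (by omega) (by omega)).1, fun h3 => (h i (by omega) (by omega)).2 (by omega)⟩

theorem Run.succ {B : ℕ → Prop} {A : Finset ℕ} {u v : ℕ} (h : Run B A u v) (hA : v + 1 ∈ A)
    (hB : ¬ B (v + 1)) : Run B A u (v + 1) := by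
  intro i h1 h2
  rcases Nat.lt_or_ge v i with h3 | h3
  · obtain rfl : i = v + 1 := by omega
    exact ⟨hA, fun _ => hB⟩
  · exact h i h1 h3

theorem exists_start {B : ℕ → Prop} (hB : B 0) (A : Finset ℕ) {v : ℕ} (hv : v ∈ A) :
    ∃ u ≤ v, u ∈ starts B A ∧ Run B A u v := by
  classical
  induction v with
  | zero =>
    -- Truncated subtraction makes `0 - 1 ∉ A` false when `0 ∈ A`, so position 0 is a start only
    -- thanks to `B 0`.
    refine ⟨0, le_rfl, by simp [starts, hv, hB], fun i h1 h2 => ?_⟩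
    obtain rfl : i = 0 := by omega
    exact ⟨hv, by omega⟩
  | succ v ih =>
    by_cases h : B (v + 1) ∨ v ∉ A
    · refine ⟨v + 1, le_rfl, by simp [starts, hv, h], fun i h1 h2 => ?_⟩
      obtain rfl : i = v + 1 := by omega
      exact ⟨hv, by omega⟩
    · push Not at h
      obtain ⟨u, hu, hs, hr⟩ := ih h.2
      exact ⟨u, by omega, hs, hr.succ hv h.1⟩

section

variable {B : ℕ → Prop} {W : ℕ → ℝ}

/-- Removing an interval can create only one new start, just after its right end. -/
theorem sliceWeight_sdiff_le (hW0 : ∀ i, 0 ≤ W i) (A : Finset ℕ) (a b : ℕ) :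
    open Classical in
    sliceWeight B W (A \ Finset.Icc a b) ≤
      ∑ i ∈ starts B A \ Finset.Icc a b, W i + if b + 1 ∈ A ∧ ¬ B (b + 1) then W (b + 1) else 0 := by
  classical
  have key : starts B (A \ Finset.Icc a b) ⊆ (starts B A \ Finset.Icc a b) ∪
      (if b + 1 ∈ A ∧ ¬ B (b + 1) then {b + 1} else ∅) := by
    intro i hi
    simp only [starts, Finset.mem_filter, Finset.mem_sdiff, Finset.mem_Icc, not_and,
      not_le] at hi
    by_cases h : B i ∨ i - 1 ∉ A
    · exact Finset.mem_union_left _ (by simp [starts, hi.1.1, h, Finset.mem_sdiff]; exact hi.1.2)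
    · push Not at h
      have h1 := (hi.2.resolve_left h.1) h.2
      have h2 := hi.1.2
      obtain rfl : i = b + 1 := by omega
      simp [hi.1.1, h.1]
  calc sliceWeight B W (A \ Finset.Icc a b) ≤ _ :=
        Finset.sum_le_sum_of_subset_of_nonneg key fun i _ _ => hW0 i
    _ ≤ _ := by
        have := Finset.sum_union_inter (s₁ := starts B A \ Finset.Icc a b)
          (s₂ := if b + 1 ∈ A ∧ ¬ B (b + 1) then {b + 1} else ∅) (f := W)
        have h0 := Finset.sum_nonneg (s := (starts B A \ Finset.Icc a b) ∩
          (if b + 1 ∈ A ∧ ¬ B (b + 1) then {b + 1} else ∅)) fun i _ => hW0 i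
        have h1 : ∑ i ∈ (if b + 1 ∈ A ∧ ¬ B (b + 1) then {b + 1} else (∅ : Finset ℕ)), W i =
          if b + 1 ∈ A ∧ ¬ B (b + 1) then W (b + 1) else 0 := by split_ifs <;> simp
        linarith

theorem sum_sdiff_add_le (hW0 : ∀ i, 0 ≤ W i) {S I J : Finset ℕ} (hJS : J ⊆ S) (hJI : J ⊆ I) :
    ∑ i ∈ S \ I, W i + ∑ i ∈ J, W i ≤ ∑ i ∈ S, W i := by
  rw [← Finset.sum_union]
  · apply Finset.sum_le_sum_of_subset_of_nonneg
    · exact Finset.union_subset Finset.sdiff_subset hJS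
    · exact fun i _ _ => hW0 i
  · exact Finset.disjoint_left.2 fun i hi hj => (Finset.mem_sdiff.1 hi).2 (hJI hj)

/-- If the slice of `b` starts at or before `v`, the possible new piece after `b` weighs `W v`.
Otherwise that start is itself removed and pays for the new piece. -/
theorem sliceWeight_sdiff_le_add (hB : B 0)
    (hW : ∀ i, ¬ B (i + 1) → W (i + 1) = W i) (hW0 : ∀ i, 0 ≤ W i) {A : Finset ℕ} {a v b : ℕ} (hb : b ∈ A) (hav : a ≤ v)
    (hvb : v ≤ b) : sliceWeight B W (A \ Finset.Icc a b) ≤ sliceWeight B W A + W v := by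
  classical
  have h := sliceWeight_sdiff_le (B := B) hW0 A a b
  have hn : (if b + 1 ∈ A ∧ ¬ B (b + 1) then W (b + 1) else 0) ≤ W b := by
    split_ifs with h1
    · exact (hW b h1.2).le
    · exact hW0 b
  obtain ⟨u, hub, hus, hr⟩ := exists_start hB A hb
  have hwu := hr.eq_of_const hW hub
  rcases le_or_gt u v with huv | huv
  · have h1 := (hr.mono huv le_rfl).eq_of_const hW hvb
    have h2 := sum_sdiff_add_le hW0 (S := starts B A) (I := Finset.Icc a b) (J := ∅)
      (by simp) (by simp)
    simp only [Finset.sum_empty] at h2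
    unfold sliceWeight at *
    linarith
  · have h2 := sum_sdiff_add_le hW0 (S := starts B A) (I := Finset.Icc a b) (J := {u})
      (by simpa using hus) (by simp; omega)
    simp only [Finset.sum_singleton] at h2
    have := hW0 v
    unfold sliceWeight at *
    linarith

/-- The start of the slice of `v` is removed. A piece surviving after `b` must then belong to a
different slice, whose own start is removed too and offsets it. -/
theorem sliceWeight_sdiff_le_sub (hB : B 0)
    (hW : ∀ i, ¬ B (i + 1) → W (i + 1) = W i) (hW0 : ∀ i, 0 ≤ W i) {A : Finset ℕ} {a v b : ℕ} (hv : v ∈ A) (hb : b ∈ A)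
    (hvb : v ≤ b)
    (hl : ∀ u ≤ v, Run B A u v → a ≤ u) (hu : ∀ u, v ≤ u → Run B A v u → u ≤ b) :
    sliceWeight B W (A \ Finset.Icc a b) ≤ sliceWeight B W A - W v := by
  classical
  have h := sliceWeight_sdiff_le (B := B) hW0 A a b
  obtain ⟨u, hub, hus, hr⟩ := exists_start hB A hb
  obtain ⟨z, hzv, hzs, hrz⟩ := exists_start hB A hv
  have hwu := hr.eq_of_const hW hub
  have hwz := hrz.eq_of_const hW hzv
  have haz := hl z hzv hrz
  rcases le_or_gt u v with huv | huv
  · have hn : ¬ (b + 1 ∈ A ∧ ¬ B (b + 1)) := fun h1 => by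
      have := hu (b + 1) (by omega) ((hr.succ h1.1 h1.2).mono huv le_rfl)
      omega
    rw [if_neg hn] at h
    have h2 := sum_sdiff_add_le hW0 (S := starts B A) (I := Finset.Icc a b) (J := {z})
      (by simpa using hzs) (by simp; omega)
    simp only [Finset.sum_singleton] at h2
    unfold sliceWeight at *
    linarith
  · have hn : (if b + 1 ∈ A ∧ ¬ B (b + 1) then W (b + 1) else 0) ≤ W b := by
      split_ifs with h1
      · exact (hW b h1.2).le
      · exact hW0 b
    have h2 := sum_sdiff_add_le hW0 (S := starts B A) (I := Finset.Icc a b) (J := {z, u})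
      (by simp [Finset.insert_subset_iff, hzs, hus])
      (by simp [Finset.insert_subset_iff]; omega)
    rw [Finset.sum_pair (by omega)] at h2
    unfold sliceWeight at *
    linarith

end

/-! ### Detours -/

/-- The update of the set `A` of active positions and of the set `K` of detours `(a, v, b)`, when
the positions satisfying `C` are captured by a new cluster: the detour goes from the first captured
active position `a` to the last one `b`, and is charged to an active position `v` in between. -/
def Advance (A : Finset ℕ) (K : Finset (ℕ × ℕ × ℕ)) (C : ℕ → Prop) (A' : Finset ℕ)
    (K' : Finset (ℕ × ℕ × ℕ)) : Prop :=
  (A' = A ∧ K' = K ∧ ∀ i ∈ A, ¬ C i) ∨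
  ∃ a v b, a ∈ A ∧ C a ∧ b ∈ A ∧ C b ∧ v ∈ A ∧ a ≤ v ∧ v ≤ b ∧ (∀ i ∈ A, C i → a ≤ i ∧ i ≤ b) ∧
    A' = A \ Finset.Icc a b ∧
    K' = insert (a, v, b) (K.filter fun k => ¬ (a ≤ k.1 ∧ k.1 ≤ b))

/-- The potential: the weight of the detours plus twice the weight of the slices. -/
noncomputable def potential (B : ℕ → Prop) (W : ℕ → ℝ) (A : Finset ℕ) (K : Finset (ℕ × ℕ × ℕ)) : ℝ :=
  ∑ k ∈ K, W k.2.1 + 2 * sliceWeight B W A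

theorem sum_insert_filter_le {α : Type*} [DecidableEq α] {W : α → ℝ} (hW0 : ∀ i, 0 ≤ W i)
    (K : Finset α) (P : α → Prop) [DecidablePred P] (k : α) :
    ∑ i ∈ insert k (K.filter P), W i ≤ ∑ i ∈ K, W i + W k := by
  calc ∑ i ∈ insert k (K.filter P), W i ≤ ∑ i ∈ insert k K, W i :=
        Finset.sum_le_sum_of_subset_of_nonneg
          (Finset.insert_subset_insert _ (Finset.filter_subset _ _)) fun i _ _ => hW0 i
    _ ≤ _ := by
        by_cases h : k ∈ K
        · rw [Finset.insert_eq_of_mem h]; linarith [hW0 k]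
        · rw [Finset.sum_insert h]; linarith

/-- One terminal against one geodesic. Below the critical exponent nothing changes; at it the
potential gains at most `W v + 2 * W v`; above it the change is at most `W v - 2 * W v`. The factor
2 on slices makes the last quantity negative. -/
theorem exists_advance {B : ℕ → Prop} {W : ℕ → ℝ} (hB : B 0)
    (hW : ∀ i, ¬ B (i + 1) → W (i + 1) = W i) (hW0 : ∀ i, 0 ≤ W i) (A : Finset ℕ)
    (K : Finset (ℕ × ℕ × ℕ)) {c : ℝ} (hc : 0 ≤ c) (hcW : ∀ i ∈ A, c * W i ≤ 1)
    (C : ℕ → ℕ → Prop) (hmono : ∀ g g' i, g ≤ g' → C g i → C g' i)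
    (hl : ∀ g, ∀ v ∈ A, C g v → ∀ u ≤ v, Run B A u v → C (g + 1) u)
    (hr : ∀ g, ∀ v ∈ A, C g v → ∀ u, v ≤ u → Run B A v u → C (g + 1) u) (m : ℕ) :
    ∃ (A' : ℕ → Finset ℕ) (K' : ℕ → Finset (ℕ × ℕ × ℕ)),
      (∀ g, g ≤ m → Advance A K (C g) (A' g) (K' g)) ∧
      geomAvg m (fun g => Real.exp (c * potential B W (A' g) (K' g))) ≤
        (1 + Real.exp 3 * (31 / 32) ^ m) * Real.exp (c * potential B W A K) := by
  classical
  by_cases hex : ∃ g, ∃ i ∈ A, C g i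
  · obtain ⟨v, hvA, hv⟩ := Nat.find_spec hex
    set g₀ := Nat.find hex with hg₀
    have hmin : ∀ g < g₀, ∀ i ∈ A, ¬ C g i := fun g hg i hi hC => Nat.find_min hex hg ⟨i, hi, hC⟩
    have hne : ∀ g, g₀ ≤ g → ∃ a b, a ∈ A ∧ C g a ∧ b ∈ A ∧ C g b ∧ a ≤ v ∧ v ≤ b ∧
        ∀ i ∈ A, C g i → a ≤ i ∧ i ≤ b := by
      intro g hg
      have hm : v ∈ A.filter (C g) := Finset.mem_filter.2 ⟨hvA, hmono _ _ _ hg hv⟩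
      have ha := Finset.min'_mem (A.filter (C g)) ⟨v, hm⟩
      have hb := Finset.max'_mem (A.filter (C g)) ⟨v, hm⟩
      rw [Finset.mem_filter] at ha hb
      exact ⟨_, _, ha.1, ha.2, hb.1, hb.2, Finset.min'_le _ _ hm, Finset.le_max' _ _ hm,
        fun i hi hC => ⟨Finset.min'_le _ _ (Finset.mem_filter.2 ⟨hi, hC⟩),
          Finset.le_max' _ _ (Finset.mem_filter.2 ⟨hi, hC⟩)⟩⟩
    choose! a b ha hCa hb hCb hav hvb hab using hne
    refine ⟨fun g => if g < g₀ then A else A \ Finset.Icc (a g) (b g),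
      fun g => if g < g₀ then K else
        insert (a g, v, b g) (K.filter fun k => ¬ (a g ≤ k.1 ∧ k.1 ≤ b g)), ?_, ?_⟩
    · intro g _
      by_cases hg : g < g₀
      · simp only [hg, if_true]
        exact Or.inl ⟨rfl, rfl, hmin g hg⟩
      · simp only [hg, if_false]
        have hg' := not_lt.1 hg
        exact Or.inr ⟨a g, v, b g, ha g hg', hCa g hg', hb g hg', hCb g hg', hvA, hav g hg',
          hvb g hg', hab g hg', rfl, rfl⟩
    · have hK : ∀ g, ∑ k ∈ insert (a g, v, b g)
          (K.filter fun k => ¬ (a g ≤ k.1 ∧ k.1 ≤ b g)), W k.2.1 ≤ ∑ k ∈ K, W k.2.1 + W v :=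
        fun g => sum_insert_filter_le (W := fun k : ℕ × ℕ × ℕ => W k.2.1) (fun _ => hW0 _) K _ _
      refine geomAvg_le m g₀ _ _ (c * W v) (Real.exp_pos _).le (mul_nonneg hc (hW0 v)) (hcW v hvA)
        ?_ ?_ ?_
      · intro g hg
        simp only [hg, if_true, le_refl]
      · simp only [lt_irrefl, if_false]
        rw [← Real.exp_add, Real.exp_le_exp]
        have h1 := sliceWeight_sdiff_le_add hB hW hW0 (hb g₀ le_rfl) (hav g₀ le_rfl)
          (hvb g₀ le_rfl)
        have h2 := hK g₀
        unfold potential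
        nlinarith
      · intro g hg
        simp only [hg.le.not_gt, if_false]
        rw [← Real.exp_add, Real.exp_le_exp]
        have h1 := sliceWeight_sdiff_le_sub hB hW hW0 (A := A) (a := a g) hvA (hb g hg.le)
          (hvb g hg.le)
          (fun u hu hru => (hab g hg.le u (hru u le_rfl hu).1
            (hmono _ _ _ hg (hl g₀ v hvA hv u hu hru))).1)
          (fun u hu hru => (hab g hg.le u (hru u hu le_rfl).1
            (hmono _ _ _ hg (hr g₀ v hvA hv u hu hru))).2)
        have h2 := hK g
        unfold potential
        nlinarith
  · push Not at hex
    refine ⟨fun _ => A, fun _ => K, fun g _ => Or.inl ⟨rfl, rfl, hex g⟩, ?_⟩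
    refine (geomAvg_le_const m _ _ fun _ => le_rfl).trans ?_
    have : 0 ≤ Real.exp 3 * (31 / 32 : ℝ) ^ m * Real.exp (c * potential B W A K) := by positivity
    linarith

/-! ### Shortest-path distance and geodesics. -/

section WalkLength

universe u
variable {V : Type u} {G : SimpleGraph V}

/-- The total length of a walk. -/
noncomputable def walkLength (w : Sym2 V → ℝ≥0) {u v : V} (p : G.Walk u v) : ℝ≥0 :=
  (p.edges.map w).sum

theorem walkLength_nil (w : Sym2 V → ℝ≥0) (u : V) :
    walkLength w (SimpleGraph.Walk.nil : G.Walk u u) = 0 := by simp [walkLength]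

theorem walkLength_cons (w : Sym2 V → ℝ≥0) {u v x : V} (h : G.Adj u v) (p : G.Walk v x) :
    walkLength w (SimpleGraph.Walk.cons h p) = w s(u, v) + walkLength w p := by
  simp [walkLength]

theorem walkLength_append (w : Sym2 V → ℝ≥0) {u v x : V} (p : G.Walk u v) (q : G.Walk v x) :
    walkLength w (p.append q) = walkLength w p + walkLength w q := by
  simp [walkLength, SimpleGraph.Walk.edges_append]

theorem walkLength_reverse (w : Sym2 V → ℝ≥0) {u v : V} (p : G.Walk u v) :
    walkLength w p.reverse = walkLength w p := by
  simp [walkLength, SimpleGraph.Walk.edges_reverse, List.sum_reverse]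

theorem wdist_le (w : Sym2 V → ℝ≥0) {u v : V} (p : G.Walk u v) :
    wdist G w u v ≤ walkLength w p := iInf_le _ p

theorem le_wdist {w : Sym2 V → ℝ≥0} {u v : V} {c : ℝ≥0∞}
    (h : ∀ p : G.Walk u v, c ≤ walkLength w p) : c ≤ wdist G w u v := le_iInf h

theorem wdist_self (w : Sym2 V → ℝ≥0) (u : V) : wdist G w u u = 0 :=
  le_antisymm ((wdist_le w .nil).trans (by simp [walkLength_nil])) bot_le

theorem wdist_triangle (w : Sym2 V → ℝ≥0) (u v x : V) :
    wdist G w u x ≤ wdist G w u v + wdist G w v x := by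
  refine ENNReal.le_iInf_add_iInf fun p q => (wdist_le w (p.append q)).trans ?_
  rw [walkLength_append, ENNReal.coe_add]
  rfl

theorem wdist_comm (w : Sym2 V → ℝ≥0) (u v : V) : wdist G w u v = wdist G w v u := by
  have h : ∀ u v, wdist G w u v ≤ wdist G w v u := fun u v => le_wdist fun p => by
    rw [← walkLength_reverse]; exact wdist_le w p.reverse
  exact le_antisymm (h u v) (h v u)

theorem wdist_le_of_adj (w : Sym2 V → ℝ≥0) {u v : V} (h : G.Adj u v) :
    wdist G w u v ≤ w s(u, v) := by
  refine (wdist_le w h.toWalk).trans ?_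
  simp [walkLength]

theorem wdist_mono {w w' : Sym2 V → ℝ≥0} (h : w ≤ w') (u v : V) :
    wdist G w u v ≤ wdist G w' u v :=
  le_wdist fun p => (wdist_le w p).trans <| by
    have : walkLength w p ≤ walkLength w' p := List.sum_le_sum fun e _ => h e
    exact_mod_cast this

theorem wdist_ne_top (hG : G.Connected) (w : Sym2 V → ℝ≥0) (u v : V) : wdist G w u v ≠ ∞ := by
  obtain ⟨p⟩ := hG.preconnected u v
  exact ne_top_of_le_ne_top ENNReal.coe_ne_top (wdist_le w p)

theorem wdist_getVert_add_le (w : Sym2 V → ℝ≥0) {u v : V} (p : G.Walk u v) (i : ℕ) :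
    wdist G w u (p.getVert i) + wdist G w (p.getVert i) v ≤ walkLength w p := by
  induction p generalizing i with
  | nil => simp [wdist_self]
  | @cons u x v h q ih =>
    cases i with
    | zero => simpa [wdist_self] using wdist_le w (SimpleGraph.Walk.cons h q)
    | succ i =>
      rw [SimpleGraph.Walk.getVert_cons_succ, walkLength_cons, ENNReal.coe_add]
      calc _ ≤ (wdist G w u x + wdist G w x (q.getVert i)) + wdist G w (q.getVert i) v := by
            gcongr; exact wdist_triangle ..
        _ ≤ _ := by
            rw [add_assoc]; exact add_le_add (wdist_le_of_adj w h) (ih i)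

theorem wdist_getVert_add_add_le (w : Sym2 V → ℝ≥0) {u v : V} (p : G.Walk u v) {i j : ℕ}
    (hij : i ≤ j) :
    wdist G w u (p.getVert i) + wdist G w (p.getVert i) (p.getVert j) + wdist G w (p.getVert j) v
      ≤ walkLength w p := by
  induction p generalizing i j with
  | nil => simp [wdist_self]
  | @cons u x v h q ih =>
    cases i with
    | zero => simpa [wdist_self] using wdist_getVert_add_le w (SimpleGraph.Walk.cons h q) j
    | succ i =>
      obtain ⟨j, rfl⟩ : ∃ k, j = k + 1 := ⟨j - 1, by omega⟩
      rw [SimpleGraph.Walk.getVert_cons_succ, SimpleGraph.Walk.getVert_cons_succ, walkLength_cons,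
        ENNReal.coe_add]
      calc _ ≤ (wdist G w u x + wdist G w x (q.getVert i)) +
            wdist G w (q.getVert i) (q.getVert j) + wdist G w (q.getVert j) v := by
            gcongr; exact wdist_triangle ..
        _ ≤ _ := by
            rw [add_assoc, add_assoc, ← add_assoc (wdist G w x _)]
            exact add_le_add (wdist_le_of_adj w h) (ih (by omega))

/-- Bypassing repeated vertices does not lengthen a walk, and there are finitely many paths. -/
theorem exists_walkLength_eq_wdist [Finite V] (hG : G.Connected) (w : Sym2 V → ℝ≥0) (u v : V) :
    ∃ p : G.Walk u v, wdist G w u v = walkLength w p := by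
  classical
  have := Fintype.ofFinite V
  have hfin : {p : G.Walk u v | p.IsPath ∧ p.length < Fintype.card V}.Finite := Set.toFinite _
  obtain ⟨q⟩ := hG.preconnected u v
  obtain ⟨p, -, hp⟩ := hfin.exists_minimalFor (walkLength w) _
    ⟨q.bypass, q.bypass_isPath, q.bypass_isPath.length_lt⟩
  refine ⟨p, le_antisymm (wdist_le w p) (le_wdist fun r => ?_)⟩
  have h1 : walkLength w r.bypass ≤ walkLength w r :=
    (r.edges_bypass_sublist_edges.map w).sum_le_sum fun _ _ => zero_le
  have h2 : walkLength w p ≤ walkLength w r.bypass := by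
    by_contra hlt
    exact hlt (hp ⟨r.bypass_isPath, r.bypass_isPath.length_lt⟩ (not_le.1 hlt).le)
  exact_mod_cast h2.trans h1

/-- `d` is a metric on the vertices of `G` in which any two vertices are joined by a walk in `G`
along which `d` is additive. -/
structure IsGeodesicMetric (G : SimpleGraph V) (d : V → V → ℝ) : Prop where
  self : ∀ u, d u u = 0
  symm : ∀ u v, d u v = d v u
  triangle : ∀ u v x, d u x ≤ d u v + d v x
  pos : ∀ u v, u ≠ v → 0 < d u v
  geodesic : ∀ u v, ∃ (n : ℕ) (p : ℕ → V), p 0 = u ∧ p n = v ∧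
    (∀ i < n, G.Adj (p i) (p (i + 1))) ∧
    ∀ i j, i ≤ j → j ≤ n → d (p i) (p j) = d u (p j) - d u (p i)

theorem isGeodesicMetric_wdist [Finite V] (hG : G.Connected) (w : Sym2 V → ℝ≥0)
    (hw : ∀ e, 0 < w e) : IsGeodesicMetric G fun u v => (wdist G w u v).toReal where
  self u := by simp [wdist_self]
  symm u v := by rw [wdist_comm]
  triangle u v x := by
    have f := wdist_ne_top hG w
    rw [← ENNReal.toReal_add (f u v) (f v x)]
    exact ENNReal.toReal_mono (ENNReal.add_ne_top.2 ⟨f u v, f v x⟩) (wdist_triangle ..)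
  pos u v huv := by
    obtain ⟨p, hp⟩ := exists_walkLength_eq_wdist hG w u v
    rw [hp]
    cases p with
    | nil => exact absurd rfl huv
    | cons h q =>
      rw [walkLength_cons]
      simp only [ENNReal.coe_toReal, NNReal.coe_add]
      exact add_pos_of_pos_of_nonneg (NNReal.coe_pos.2 (hw _)) (NNReal.coe_nonneg _)
  geodesic u v := by
    obtain ⟨p, hp⟩ := exists_walkLength_eq_wdist hG w u v
    refine ⟨p.length, p.getVert, by simp, by simp, fun i hi => p.adj_getVert_succ hi, ?_⟩
    intro i j hij _
    have h1 := wdist_getVert_add_add_le w p hij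
    rw [← hp] at h1
    have h2 := wdist_triangle (G := G) w u (p.getVert j) v
    have h3 := wdist_triangle (G := G) w u (p.getVert i) (p.getVert j)
    obtain ⟨d, hd⟩ : ∃ d : V → V → ℝ, ∀ a b, (wdist G w a b).toReal = d a b :=
      ⟨_, fun _ _ => rfl⟩
    have e' : ∀ a b, wdist G w a b = ENNReal.ofReal (d a b) := fun a b => by
      rw [← hd, ENNReal.ofReal_toReal (wdist_ne_top hG w a b)]
    have d0 : ∀ a b, 0 ≤ d a b := fun a b => by rw [← hd]; exact ENNReal.toReal_nonneg
    simp only [e'] at h1 h2 h3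
    simp only [hd]
    rw [← ENNReal.ofReal_add (d0 _ _) (d0 _ _),
      ← ENNReal.ofReal_add (add_nonneg (d0 _ _) (d0 _ _)) (d0 _ _),
      ENNReal.ofReal_le_ofReal_iff (d0 _ _)] at h1
    rw [← ENNReal.ofReal_add (d0 _ _) (d0 _ _),
      ENNReal.ofReal_le_ofReal_iff (add_nonneg (d0 _ _) (d0 _ _))] at h2 h3
    linarith

end WalkLength

/-! ### Clusters of bounded stretch. -/

section Clustering

universe u
variable {V : Type u} {G : SimpleGraph V} {d : V → V → ℝ} {D : V → ℝ} {T : Finset V}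

theorem IsGeodesicMetric.nonneg (hd : IsGeodesicMetric G d) (u v : V) : 0 ≤ d u v := by
  rcases eq_or_ne u v with rfl | h
  · exact (hd.self u).ge
  · exact (hd.pos u v h).le

/-- `D` is the distance to the set `T` with respect to `d`. -/
structure IsDistTo (T : Finset V) (d : V → V → ℝ) (D : V → ℝ) : Prop where
  le : ∀ t ∈ T, ∀ v, D v ≤ d v t
  attained : ∀ v, ∃ t ∈ T, D v = d v t

theorem exists_isDistTo (hT : T.Nonempty) (d : V → V → ℝ) : ∃ D, IsDistTo T d D :=
  ⟨fun v => T.inf' hT (d v), fun _ ht v => Finset.inf'_le (d v) ht,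
    fun v => Finset.exists_mem_eq_inf' hT (d v)⟩

theorem IsDistTo.nonneg (hD : IsDistTo T d D) (hd : IsGeodesicMetric G d) (v : V) : 0 ≤ D v := by
  obtain ⟨t, -, h⟩ := hD.attained v
  rw [h]
  exact hd.nonneg v t

theorem IsDistTo.eq_zero (hD : IsDistTo T d D) (hd : IsGeodesicMetric G d) {t : V} (ht : t ∈ T) :
    D t = 0 :=
  le_antisymm ((hD.le t ht t).trans_eq (hd.self t)) (hD.nonneg hd t)

theorem IsDistTo.le_add (hD : IsDistTo T d D) (hd : IsGeodesicMetric G d) (u v : V) :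
    D u ≤ D v + d u v := by
  obtain ⟨t, ht, h⟩ := hD.attained v
  have := hD.le t ht u
  have := hd.triangle u v t
  linarith

/-- The vertices which can be reached from `t` through vertices `b` that are not yet assigned and
satisfy `d b t ≤ r * D b`. -/
def cluster (G : SimpleGraph V) (d : V → V → ℝ) (D : V → ℝ) (f : V → Option V) (t : V) (r : ℝ) :
    Set V :=
  {v | Relation.ReflTransGen (fun a b => G.Adj a b ∧ f b = none ∧ d b t ≤ r * D b) t v}

theorem self_mem_cluster (f : V → Option V) (t : V) (r : ℝ) : t ∈ cluster G d D f t r :=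
  Relation.ReflTransGen.refl

theorem mem_cluster_of_adj {f : V → Option V} {t : V} {r : ℝ} {a b : V}
    (ha : a ∈ cluster G d D f t r) (hab : G.Adj a b) (hb : f b = none) (h : d b t ≤ r * D b) :
    b ∈ cluster G d D f t r :=
  Relation.ReflTransGen.tail ha ⟨hab, hb, h⟩

theorem of_mem_cluster (hd : IsGeodesicMetric G d) (hD : IsDistTo T d D) {f : V → Option V} {t : V}
    {r : ℝ} (hr : 0 ≤ r) (ht : f t = none) {v : V} (hv : v ∈ cluster G d D f t r) :
    f v = none ∧ d v t ≤ r * D v := by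
  rcases Relation.ReflTransGen.cases_tail hv with rfl | ⟨b, -, hb⟩
  · exact ⟨ht, by rw [hd.self]; exact mul_nonneg hr (hD.nonneg hd v)⟩
  · exact hb.2

theorem cluster_mono (hd : IsGeodesicMetric G d) (hD : IsDistTo T d D) (f : V → Option V) (t : V)
    {r r' : ℝ} (h : r ≤ r') : cluster G d D f t r ⊆ cluster G d D f t r' := fun _ hv =>
  Relation.ReflTransGen.mono (fun _ b hab => ⟨hab.1, hab.2.1, hab.2.2.trans
    (mul_le_mul_of_nonneg_right h (hD.nonneg hd b))⟩) _ _ hv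

open Classical in
/-- Assign the vertices in `C` to `t`. -/
noncomputable def assign (f : V → Option V) (t : V) (C : Set V) : V → Option V :=
  fun v => if v ∈ C then some t else f v

theorem assign_of_mem {f : V → Option V} {t : V} {C : Set V} {v : V} (h : v ∈ C) :
    assign f t C v = some t := if_pos h

theorem assign_of_notMem {f : V → Option V} {t : V} {C : Set V} {v : V} (h : v ∉ C) :
    assign f t C v = f v := if_neg h

/-- The partial map `f` assigns vertices to the terminals in `S`, with connected clusters of
stretch at most `R`, and such that the assigned set is closed under moving away from the
terminals along shortest paths. -/
structure IsPartialClustering (G : SimpleGraph V) (d : V → V → ℝ) (D : V → ℝ) (R : ℝ)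
    (S : Finset V) (f : V → Option V) : Prop where
  mem : ∀ v t, f v = some t → t ∈ S
  near : ∀ v t, f v = some t → d v t ≤ R * D v
  center : ∀ t ∈ S, f t = some t
  connected : ∀ v t, f v = some t →
    Relation.ReflTransGen (fun a b => G.Adj a b ∧ f b = some t) t v
  closed : ∀ u v, f u ≠ none → G.Adj u v → D v = D u + d u v → f v ≠ none

/-- `D` vanishes at terminals, so a terminal can be close only to itself. This relies on `d`
separating points, which is why zero edge lengths are treated separately. -/
theorem IsPartialClustering.eq_none (hd : IsGeodesicMetric G d) (hD : IsDistTo T d D) {R : ℝ}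
    {S : Finset V} {f : V → Option V} (hf : IsPartialClustering G d D R S f) {t : V} (htT : t ∈ T)
    (htS : t ∉ S) : f t = none := by
  rcases hft : f t with _ | t'
  · rfl
  · have h := hf.near t t' hft
    rw [hD.eq_zero hd htT, mul_zero] at h
    have : t = t' := by
      by_contra hne
      exact absurd (hd.pos t t' hne) h.not_gt
    exact absurd (this ▸ hf.mem t t' hft) htS

theorem IsPartialClustering.assign_cluster [DecidableEq V] (hd : IsGeodesicMetric G d)
    (hD : IsDistTo T d D) {R r : ℝ} {S : Finset V} {f : V → Option V}
    (hf : IsPartialClustering G d D R S f) {t : V} (htT : t ∈ T) (htS : t ∉ S) (hr : 1 ≤ r)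
    (hrR : r ≤ R) :
    IsPartialClustering G d D R (insert t S) (assign f t (cluster G d D f t r)) := by
  have hft := hf.eq_none hd hD htT htS
  have hmem : ∀ v ∈ cluster G d D f t r, f v = none ∧ d v t ≤ r * D v :=
    fun v hv => of_mem_cluster hd hD (by linarith) hft hv
  have hold : ∀ v s, f v = some s → assign f t (cluster G d D f t r) v = some s := by
    intro v s hv
    rw [assign_of_notMem, hv]
    intro h
    simp [(hmem v h).1] at hv
  constructor
  · intro v s hs
    by_cases hv : v ∈ cluster G d D f t r
    · rw [assign_of_mem hv] at hs
      cases hs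
      exact Finset.mem_insert_self _ _
    · rw [assign_of_notMem hv] at hs
      exact Finset.mem_insert_of_mem (hf.mem v s hs)
  · intro v s hs
    by_cases hv : v ∈ cluster G d D f t r
    · rw [assign_of_mem hv] at hs
      cases hs
      exact (hmem v hv).2.trans (mul_le_mul_of_nonneg_right hrR (hD.nonneg hd v))
    · rw [assign_of_notMem hv] at hs
      exact hf.near v s hs
  · intro s hs
    rcases Finset.mem_insert.1 hs with rfl | hs
    · exact assign_of_mem (self_mem_cluster ..)
    · exact hold s s (hf.center s hs)
  · intro v s hs
    by_cases hv : v ∈ cluster G d D f t r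
    · rw [assign_of_mem hv] at hs
      cases hs
      have hv' := hv
      simp only [cluster, Set.mem_ofPred_eq] at hv'
      clear hv
      induction hv' with
      | refl => exact .refl
      | tail h h' ih => exact ih.tail ⟨h'.1, assign_of_mem (h.tail h')⟩
    · rw [assign_of_notMem hv] at hs
      exact Relation.ReflTransGen.mono (fun a b h => ⟨h.1, hold b s h.2⟩) _ _ (hf.connected v s hs)
  · intro u v hu huv hDv hv
    have hvC : v ∉ cluster G d D f t r := fun h => by simp [assign_of_mem h] at hv
    rw [assign_of_notMem hvC] at hv
    by_cases huC : u ∈ cluster G d D f t r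
    -- Moving away from the terminals adds the same length to `D` and at most that length to the
    -- distance from `t`; since `1 ≤ r`, the bound persists.
    · refine hvC (mem_cluster_of_adj huC huv hv ?_)
      have h1 := (hmem u huC).2
      have h2 := hd.triangle v u t
      rw [hd.symm v u] at h2
      rw [hDv]
      nlinarith [hd.nonneg u v]
    · rw [assign_of_notMem huC] at hu
      exact hf.closed u v hu huv hDv hv

theorem isPartialClustering_none (R : ℝ) :
    IsPartialClustering G d D R ∅ fun _ => none := by
  constructor <;> simp

/-- Start at the nearest terminal, which is assigned, and propagate by `closed` along a geodesic to
`v`. -/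
theorem IsPartialClustering.ne_none (hd : IsGeodesicMetric G d) (hD : IsDistTo T d D) {R : ℝ}
    {f : V → Option V} (hf : IsPartialClustering G d D R T f) (v : V) : f v ≠ none := by
  obtain ⟨t, ht, htv⟩ := hD.attained v
  obtain ⟨n, p, h0, hn, hadj, hp⟩ := hd.geodesic t v
  have key : ∀ i ≤ n, D (p i) = d t (p i) := by
    intro i hi
    have h1 := hD.le t ht (p i)
    have h2 := hD.le_add hd v (p i)
    have h3 := hp i n hi le_rfl
    rw [hd.symm] at h1
    rw [hn, hd.symm] at h3
    rw [hd.symm v t] at htv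
    linarith
  have : ∀ i ≤ n, f (p i) ≠ none := by
    intro i
    induction i with
    | zero => intro _; rw [h0, hf.center t ht]; simp
    | succ i ih =>
      intro hi
      refine hf.closed (p i) _ (ih (by omega)) (hadj i (by omega)) ?_
      rw [key i (by omega), key (i + 1) hi, hp i (i + 1) (by omega) hi]
      ring
  exact hn ▸ this n le_rfl

/-! ### Blocks of a geodesic -/

/-- `p 0, …, p n` is a walk in `G` along which `d` is additive. -/
structure IsGeodesic (G : SimpleGraph V) (d : V → V → ℝ) (n : ℕ) (p : ℕ → V) : Prop where
  adj : ∀ i < n, G.Adj (p i) (p (i + 1))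
  additive : ∀ i j, i ≤ j → j ≤ n → d (p i) (p j) = d (p 0) (p j) - d (p 0) (p i)

open Classical in
/-- The first position of the block containing `i`: a block is extended as long as the distance
from its first vertex `v` is at most `η * D v`. -/
noncomputable def leader (d : V → V → ℝ) (D : V → ℝ) (η : ℝ) (p : ℕ → V) : ℕ → ℕ
  | 0 => 0
  | i + 1 => if d (p (leader d D η p i)) (p (i + 1)) ≤ η * D (p (leader d D η p i)) then
      leader d D η p i else i + 1

theorem leader_le (η : ℝ) (p : ℕ → V) (i : ℕ) : leader d D η p i ≤ i := by
  induction i with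
  | zero => rfl
  | succ i ih => rw [leader]; split_ifs <;> omega

theorem leader_succ (η : ℝ) (p : ℕ → V) (i : ℕ) (h : leader d D η p (i + 1) ≠ i + 1) :
    leader d D η p (i + 1) = leader d D η p i := by
  rw [leader] at h ⊢
  split_ifs at h ⊢ <;> simp_all

theorem dist_leader_le (hd : IsGeodesicMetric G d) (hD : IsDistTo T d D) {η : ℝ} (hη : 0 ≤ η)
    (p : ℕ → V) (i : ℕ) :
    d (p (leader d D η p i)) (p i) ≤ η * D (p (leader d D η p i)) := by
  have h0 : ∀ i, d (p i) (p i) ≤ η * D (p i) := fun i => by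
    rw [hd.self]; exact mul_nonneg hη (hD.nonneg hd _)
  cases i with
  | zero => exact h0 0
  | succ i =>
    rw [leader]
    split_ifs with h
    · exact h
    · exact h0 (i + 1)

/-- The sum of the distances to the terminals over the first vertices of the blocks. -/
theorem sum_leader_le (hd : IsGeodesicMetric G d) (hD : IsDistTo T d D) {η : ℝ}
    (hη1 : η ≤ 1) {n : ℕ} {p : ℕ → V} (hp : IsGeodesic G d n p) (hnT : p n ∈ T) :
    η * ∑ i ∈ (Finset.range (n + 1)).filter (fun i => leader d D η p i = i), D (p i) ≤
      d (p 0) (p n) := by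
  -- A new block starts only beyond distance `η * D` of the previous leader, so each block but the
  -- last pays for itself. The last is paid for by its distance to the terminal `p n`.
  have key : ∀ m ≤ n,
      η * ∑ i ∈ (Finset.range (m + 1)).filter (fun i => leader d D η p i = i), D (p i) ≤
        d (p 0) (p (leader d D η p m)) + η * D (p (leader d D η p m)) := by
    intro m
    induction m with
    | zero => intro _; simp [leader, hd.self, Finset.filter_singleton]
    | succ m ih =>
      intro hm
      specialize ih (by omega)
      rw [Finset.range_add_one, Finset.filter_insert]
      by_cases h : leader d D η p (m + 1) = m + 1
      · rw [if_pos h, Finset.sum_insert (by simp), mul_add, h]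
        have h1 : η * D (p (leader d D η p m)) <
            d (p (leader d D η p m)) (p (m + 1)) := by
          by_contra hlt
          have h2 := leader_le (d := d) (D := D) η p m
          rw [leader, if_pos (not_lt.1 hlt)] at h
          omega
        rw [hp.additive _ _ ((leader_le η p m).trans (by omega)) hm] at h1
        linarith
      · rw [if_neg h, leader_succ η p m h]
        exact ih
  have h1 := key n le_rfl
  have h2 := hp.additive _ _ (leader_le (d := d) (D := D) η p n) le_rfl
  have h3 := hD.le _ hnT (p (leader d D η p n))
  have h4 := hD.nonneg hd (p (leader d D η p n))
  nlinarith

/-- With blocks of radius `δ / 8`, two positions of a block are within `δ / 2 * D (p i)` of each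
other. This enters once directly and once multiplied by `r`, and `1 ≤ r` absorbs the sum. -/
theorem stretch_le_of_leader_eq (hd : IsGeodesicMetric G d) (hD : IsDistTo T d D) {δ : ℝ}
    (hδ : 0 ≤ δ) (hδ1 : δ ≤ 1) {p : ℕ → V} {i j : ℕ}
    (h : leader d D (δ / 8) p i = leader d D (δ / 8) p j) {r : ℝ} (hr : 1 ≤ r) {t : V}
    (hj : d (p j) t ≤ r * D (p j)) : d (p i) t ≤ (r * (1 + δ)) * D (p i) := by
  have hi' := dist_leader_le hd hD (by positivity : 0 ≤ δ / 8) p i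
  have hj' := dist_leader_le hd hD (by positivity : 0 ≤ δ / 8) p j
  rw [← h] at hj'
  set l := leader d D (δ / 8) p i
  have h1 := hd.triangle (p i) (p l) (p j)
  have h2 := hd.triangle (p i) (p j) t
  have h3 := hD.le_add hd (p j) (p i)
  have h4 := hD.le_add hd (p l) (p i)
  rw [hd.symm (p i) (p l)] at h1
  rw [hd.symm (p j) (p i)] at h3
  have h5 := hD.nonneg hd (p l)
  have h6 : D (p l) ≤ 2 * D (p i) := by nlinarith
  have h7 : 2 * d (p i) (p j) ≤ δ * D (p i) := by nlinarith
  have h8 := hd.nonneg (p i) (p j)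
  nlinarith

/-- One more factor `1 + δ` suffices for every position of the slice, and consecutive positions are
adjacent and unassigned, so the cluster spreads along the slice. -/
theorem mem_cluster_of_run (hd : IsGeodesicMetric G d) (hD : IsDistTo T d D) {δ : ℝ}
    (hδ : 0 ≤ δ) (hδ1 : δ ≤ 1) {n : ℕ} {p : ℕ → V} (hp : IsGeodesic G d n p) {f : V → Option V}
    {A : Finset ℕ} (hA : ∀ i ∈ A, i ≤ n ∧ f (p i) = none) {t : V} (ht : f t = none) {r : ℝ}
    (hr : 1 ≤ r) {v : ℕ} (hv : p v ∈ cluster G d D f t r) {u : ℕ}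
    (hu : (u ≤ v ∧ Run (fun i => leader d D (δ / 8) p i = i) A u v) ∨
      (v ≤ u ∧ Run (fun i => leader d D (δ / 8) p i = i) A v u)) :
    p u ∈ cluster G d D f t (r * (1 + δ)) := by
  have hv0 := (of_mem_cluster hd hD (by linarith) ht hv).2
  have hv1 : p v ∈ cluster G d D f t (r * (1 + δ)) :=
    cluster_mono hd hD f t (by nlinarith) hv
  have hW := leader_succ (d := d) (D := D) (δ / 8) p
  rcases hu with ⟨huv, hrun⟩ | ⟨hvu, hrun⟩
  · obtain ⟨k, rfl⟩ := Nat.exists_eq_add_of_le huv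
    clear huv
    induction k generalizing u with
    | zero => exact hv1
    | succ k ih =>
      have hu1 : u + 1 + k = u + (k + 1) := by omega
      have hu := hA u (hrun u le_rfl (by omega)).1
      have hu' := hA (u + 1) (hrun (u + 1) (by omega) (by omega)).1
      have hnext := ih (u := u + 1) (hu1 ▸ hv) (hu1 ▸ hv0) (hu1 ▸ hv1)
        (hu1 ▸ hrun.mono (by omega) le_rfl)
      exact mem_cluster_of_adj hnext (hp.adj u (by omega)).symm hu.2
        (stretch_le_of_leader_eq hd hD hδ hδ1 (hrun.eq_of_const hW (by omega)) hr hv0)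
  · induction u, hvu using Nat.le_induction with
    | base => exact hv1
    | succ u hvu ih =>
      have hu := hA (u + 1) (hrun (u + 1) (by omega) le_rfl).1
      exact mem_cluster_of_adj (ih (hrun.mono le_rfl (by omega))) (hp.adj u (by omega)) hu.2
        (stretch_le_of_leader_eq hd hD hδ hδ1 (hrun.eq_of_const hW (by omega)).symm hr hv0)

/-! ### Detours along a geodesic -/

/-- The positions `0, …, n` of `p` are either in the set `A` of active positions, which are not
assigned by `f`, or covered by exactly one of the detours in `K`, whose ends are assigned to the
same terminal. -/
structure Tracks (f : V → Option V) (n : ℕ) (p : ℕ → V) (A : Finset ℕ)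
    (K : Finset (ℕ × ℕ × ℕ)) : Prop where
  active : ∀ i ∈ A, i ≤ n ∧ f (p i) = none
  cover : ∀ i ≤ n, i ∉ A → ∃ k ∈ K, k.1 ≤ i ∧ i ≤ k.2.2
  le : ∀ k ∈ K, k.1 ≤ k.2.1 ∧ k.2.1 ≤ k.2.2 ∧ k.2.2 ≤ n
  same : ∀ k ∈ K, ∃ t, f (p k.1) = some t ∧ f (p k.2.2) = some t
  inactive : ∀ k ∈ K, ∀ i ∈ A, ¬ (k.1 ≤ i ∧ i ≤ k.2.2)
  disjoint : ∀ k ∈ K, ∀ k' ∈ K, k ≠ k' → k.2.2 < k'.1 ∨ k'.2.2 < k.1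

theorem tracks_none (n : ℕ) (p : ℕ → V) :
    Tracks (fun _ => none) n p (Finset.range (n + 1)) ∅ := by
  constructor <;> simp

theorem Tracks.advance {f : V → Option V} {n : ℕ} {p : ℕ → V} {A A' : Finset ℕ}
    {K K' : Finset (ℕ × ℕ × ℕ)} (h : Tracks f n p A K) {t : V} {C : Set V}
    (hC : ∀ v ∈ C, f v = none) (hadv : Advance A K (fun i => p i ∈ C) A' K') :
    Tracks (assign f t C) n p A' K' := by
  have hold : ∀ v s, f v = some s → assign f t C v = some s := by
    intro v s hv
    rw [assign_of_notMem, hv]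
    intro h
    simp [hC v h] at hv
  rcases hadv with ⟨rfl, rfl, hn⟩ | ⟨a, v, b, ha, hCa, hb, hCb, hv, hav, hvb, hab, rfl, rfl⟩
  · refine ⟨fun i hi => ⟨(h.active i hi).1, ?_⟩, h.cover, h.le, fun k hk => ?_, h.inactive,
      h.disjoint⟩
    · rw [assign_of_notMem (hn i hi)]; exact (h.active i hi).2
    · obtain ⟨s, h1, h2⟩ := h.same k hk
      exact ⟨s, hold _ _ h1, hold _ _ h2⟩
  · refine ⟨fun i hi => ?_, fun i hi hiA => ?_, ?_, ?_, ?_, ?_⟩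
    · rw [Finset.mem_sdiff, Finset.mem_Icc] at hi
      refine ⟨(h.active i hi.1).1, ?_⟩
      rw [assign_of_notMem fun hc => hi.2 (hab i hi.1 hc)]
      exact (h.active i hi.1).2
    · by_cases hi' : a ≤ i ∧ i ≤ b
      · exact ⟨_, Finset.mem_insert_self _ _, hi'⟩
      · have : i ∉ A := fun hA => hiA (by
          rw [Finset.mem_sdiff, Finset.mem_Icc]; exact ⟨hA, hi'⟩)
        obtain ⟨k, hk, hki⟩ := h.cover i hi this
        refine ⟨k, Finset.mem_insert_of_mem (Finset.mem_filter.2 ⟨hk, fun hk' => ?_⟩), hki⟩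
        -- A discarded detour starts in `[a, b]`; were it to reach outside, it would contain the
        -- active position `b`.
        have := h.inactive k hk b hb
        omega
    · intro k hk
      rcases Finset.mem_insert.1 hk with rfl | hk
      · exact ⟨hav, hvb, (h.active b hb).1⟩
      · exact h.le k (Finset.mem_filter.1 hk).1
    · intro k hk
      rcases Finset.mem_insert.1 hk with rfl | hk
      · exact ⟨t, assign_of_mem hCa, assign_of_mem hCb⟩
      · obtain ⟨s, h1, h2⟩ := h.same k (Finset.mem_filter.1 hk).1
        exact ⟨s, hold _ _ h1, hold _ _ h2⟩
    · intro k hk i hi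
      rw [Finset.mem_sdiff, Finset.mem_Icc] at hi
      rcases Finset.mem_insert.1 hk with rfl | hk
      · exact hi.2
      · exact h.inactive k (Finset.mem_filter.1 hk).1 i hi.1
    · have key : ∀ k ∈ K.filter (fun k => ¬ (a ≤ k.1 ∧ k.1 ≤ b)), k.2.2 < a ∨ b < k.1 := by
        intro k hk
        rw [Finset.mem_filter] at hk
        have := h.inactive k hk.1 a ha
        omega
      intro k hk k' hk' hne
      rcases Finset.mem_insert.1 hk with rfl | hk <;> rcases Finset.mem_insert.1 hk' with rfl | hk'
      · exact absurd rfl hne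
      · exact (key k' hk').symm
      · exact key k hk
      · exact h.disjoint k (Finset.mem_filter.1 hk).1 k' (Finset.mem_filter.1 hk').1 hne

/-! ### The clustering -/

theorem potential_range_le (hd : IsGeodesicMetric G d) (hD : IsDistTo T d D) {δ : ℝ}
    (hδ : 0 < δ) (hδ1 : δ ≤ 1) {n : ℕ} {p : ℕ → V} (hp : IsGeodesic G d n p) (hnT : p n ∈ T) :
    potential (fun i => leader d D (δ / 8) p i = i) (fun i => D (p (leader d D (δ / 8) p i)))
      (Finset.range (n + 1)) ∅ ≤ 16 / δ * d (p 0) (p n) := by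
  have h := sum_leader_le hd hD (by linarith : δ / 8 ≤ 1) hp hnT
  have e : sliceWeight (fun i => leader d D (δ / 8) p i = i)
      (fun i => D (p (leader d D (δ / 8) p i))) (Finset.range (n + 1)) =
      ∑ i ∈ (Finset.range (n + 1)).filter (fun i => leader d D (δ / 8) p i = i), D (p i) := by
    unfold sliceWeight
    refine Finset.sum_congr ?_ ?_
    · ext i
      simp only [starts, Finset.mem_filter, Finset.mem_range]
      constructor
      · rintro ⟨h1, h2 | h2⟩
        · exact ⟨h1, h2⟩
        · omega
      · exact fun h => ⟨h.1, Or.inl h.2⟩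
    · intro i hi
      simp only [(Finset.mem_filter.1 hi).2]
  rw [potential, e, Finset.sum_empty, zero_add, div_mul_eq_mul_div, le_div_iff₀ hδ]
  linarith

theorem dist_leader_le_length (hd : IsGeodesicMetric G d) (hD : IsDistTo T d D) {η : ℝ} {n : ℕ}
    {p : ℕ → V} (hp : IsGeodesic G d n p) (h0 : p 0 ∈ T) {i : ℕ} (hi : i ≤ n) :
    D (p (leader d D η p i)) ≤ d (p 0) (p n) := by
  have h1 := hD.le _ h0 (p (leader d D η p i))
  have h2 := hp.additive _ _ ((leader_le (d := d) (D := D) η p i).trans hi) le_rfl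
  have h3 := hd.nonneg (p (leader d D η p i)) (p n)
  rw [hd.symm] at h1
  linarith

/-- Method of conditional expectations: all geodesics share the exponent of each terminal, so the
sum of their exponential potentials is what is controlled. Scaling by the inverse length keeps each
scaled weight at most 1, as `exists_advance` requires. -/
theorem exists_clustering (hd : IsGeodesicMetric G d) (hD : IsDistTo T d D) {δ : ℝ}
    (hδ : 0 < δ) (hδ1 : δ ≤ 1) (m : ℕ) {ι : Type*} [Fintype ι] (n : ι → ℕ) (p : ι → ℕ → V)
    (hp : ∀ i, IsGeodesic G d (n i) (p i)) (h0 : ∀ i, p i 0 ∈ T) (hn : ∀ i, p i (n i) ∈ T)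
    (hne : ∀ i, p i 0 ≠ p i (n i)) (S : Finset V) (hS : S ⊆ T) :
    ∃ f : V → Option V, IsPartialClustering G d D ((1 + δ) ^ m) S f ∧
      ∃ (A : ι → Finset ℕ) (K : ι → Finset (ℕ × ℕ × ℕ)),
        (∀ i, Tracks f (n i) (p i) (A i) (K i)) ∧
        ∑ i, Real.exp ((d (p i 0) (p i (n i)))⁻¹ *
          potential (fun j => leader d D (δ / 8) (p i) j = j)
            (fun j => D (p i (leader d D (δ / 8) (p i) j))) (A i) (K i)) ≤
        (1 + Real.exp 3 * (31 / 32) ^ m) ^ S.card * (Fintype.card ι * Real.exp (16 / δ)) := by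
  classical
  have hL : ∀ i, 0 < d (p i 0) (p i (n i)) := fun i => hd.pos _ _ (hne i)
  induction S using Finset.induction_on with
  | empty =>
    refine ⟨fun _ => none, isPartialClustering_none _, fun i => Finset.range (n i + 1),
      fun _ => ∅, fun i => tracks_none _ _, ?_⟩
    simp only [Finset.card_empty, pow_zero, one_mul]
    rw [← nsmul_eq_mul, ← Finset.card_univ, ← Finset.sum_const]
    refine Finset.sum_le_sum fun i _ => Real.exp_le_exp.2 ?_
    rw [inv_mul_le_iff₀ (hL i), mul_comm]
    exact potential_range_le hd hD hδ hδ1 (hp i) (hn i)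
  | insert t S htS ih =>
    obtain ⟨f, hf, A, K, htr, hpot⟩ := ih ((Finset.subset_insert _ _).trans hS)
    have htT := hS (Finset.mem_insert_self t S)
    have hft := hf.eq_none hd hD htT htS
    have hr : ∀ g : ℕ, 1 ≤ (1 + δ) ^ g := fun g => one_le_pow₀ (by linarith)
    have hstep := fun i => exists_advance (B := fun j => leader d D (δ / 8) (p i) j = j)
      (W := fun j => D (p i (leader d D (δ / 8) (p i) j))) rfl
      (fun j hj => congrArg (fun l => D (p i l)) (leader_succ (δ / 8) (p i) j hj)) (fun j => hD.nonneg hd _)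
      (A i) (K i) (inv_nonneg.2 (hL i).le)
      (fun j hj => by
        rw [inv_mul_le_iff₀ (hL i), mul_one]
        exact dist_leader_le_length hd hD (hp i) (h0 i) ((htr i).active j hj).1)
      (fun g j => p i j ∈ cluster G d D f t ((1 + δ) ^ g))
      (fun g g' j hg hj => cluster_mono hd hD f t (pow_le_pow_right₀ (by linarith) hg) hj)
      (fun g v _ hv u huv hrun => by
        rw [pow_succ]
        exact mem_cluster_of_run hd hD hδ.le hδ1 (hp i) (htr i).active hft (hr g) hv
          (Or.inl ⟨huv, hrun⟩))
      (fun g v _ hv u huv hrun => by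
        rw [pow_succ]
        exact mem_cluster_of_run hd hD hδ.le hδ1 (hp i) (htr i).active hft (hr g) hv
          (Or.inr ⟨huv, hrun⟩)) m
    choose A' K' hadv havg using hstep
    obtain ⟨g, hg, hle⟩ := exists_le_geomAvg m fun g => ∑ i, Real.exp
      ((d (p i 0) (p i (n i)))⁻¹ * potential (fun j => leader d D (δ / 8) (p i) j = j)
        (fun j => D (p i (leader d D (δ / 8) (p i) j))) (A' i g) (K' i g))
    refine ⟨_, hf.assign_cluster hd hD htT htS (hr g) (pow_le_pow_right₀ (by linarith) hg),
      fun i => A' i g, fun i => K' i g, fun i => (htr i).advance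
        (fun v hv => (of_mem_cluster hd hD (by linarith [hr g]) hft hv).1) (hadv i g hg),
      hle.trans ?_⟩
    rw [geomAvg_sum]
    refine (Finset.sum_le_sum fun i _ => havg i).trans ?_
    rw [← Finset.mul_sum, Finset.card_insert_of_notMem htS, pow_succ', mul_assoc]
    exact mul_le_mul_of_nonneg_left hpot (by positivity)

end Clustering

/-! ### From detours to distances in the minor. -/

section Chain

universe u
variable {V : Type u} {G : SimpleGraph V} {d : V → V → ℝ} {D : V → ℝ} {T : Finset V}

/-- If all positions of a geodesic between terminals are covered by detours, then following the
detours bounds the distance `dH` between the ends. -/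
theorem Tracks.chain_le (hd : IsGeodesicMetric G d) (hD : IsDistTo T d D) {R : ℝ} (hR : 1 ≤ R)
    {f : V → Option V} (hf : IsPartialClustering G d D R T f) {n : ℕ} {p : ℕ → V}
    (hp : IsGeodesic G d n p) (hnT : p n ∈ T) {K : Finset (ℕ × ℕ × ℕ)}
    (h : Tracks f n p ∅ K) (h0T : p 0 ∈ T) {W : ℕ → ℝ} (hW0 : ∀ i, 0 ≤ W i)
    (hW : ∀ i, D (p i) ≤ 2 * W i) (dH : V → V → ℝ≥0∞) (hself : ∀ t, dH t t = 0)
    (htri : ∀ r s t, dH r t ≤ dH r s + dH s t)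
    (hadj : ∀ x y a b, G.Adj x y → f x = some a → f y = some b →
      dH a b ≤ ENNReal.ofReal (d a b)) :
    dH (p 0) (p n) ≤ ENNReal.ofReal (R * (4 * ∑ k ∈ K, W k.2.1 + d (p 0) (p n))) := by
  classical
  have hR0 : 0 ≤ R := by linarith
  have hend : ∀ k ∈ K, ∀ t, f (p k.1) = some t → f (p k.2.2) = some t →
      d (p k.1) t + d (p k.2.2) t ≤
        R * (4 * W k.2.1 + (d (p 0) (p k.2.2) - d (p 0) (p k.1))) := by
    intro k hk t h1 h2
    obtain ⟨l1, l2, l3⟩ := h.le k hk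
    have n1 := hf.near _ _ h1
    have n2 := hf.near _ _ h2
    have e1 := hp.additive k.1 k.2.1 l1 (by omega)
    have e2 := hp.additive k.2.1 k.2.2 l2 l3
    have s1 := hD.le_add hd (p k.1) (p k.2.1)
    have s2 := hD.le_add hd (p k.2.2) (p k.2.1)
    rw [hd.symm (p k.2.2)] at s2
    have s3 := hW k.2.1
    have : D (p k.1) + D (p k.2.2) ≤
        4 * W k.2.1 + (d (p 0) (p k.2.2) - d (p 0) (p k.1)) := by linarith
    nlinarith
  -- The term `d (p b) t` on the left is paid in advance: it is the first leg of the next hop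
  -- between terminals.
  have key : ∀ b, ∀ k ∈ K, k.2.2 = b → ∀ t, f (p b) = some t →
      dH (p 0) t + ENNReal.ofReal (d (p b) t) ≤ ENNReal.ofReal
        (R * (4 * ∑ k' ∈ K.filter (fun k' => k'.2.2 ≤ b), W k'.2.1 + d (p 0) (p b))) := by
    intro b
    induction b using Nat.strong_induction_on with
    | _ b ih =>
      rintro k hk rfl t ht
      obtain ⟨l1, l2, l3⟩ := h.le k hk
      obtain ⟨t', ht1, ht2⟩ := h.same k hk
      obtain rfl : t' = t := Option.some_injective _ (ht2.symm.trans ht)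
      have hkt := hend k hk t' ht1 ht2
      have hmem : k ∈ K.filter (fun k' => k'.2.2 ≤ k.2.2) := Finset.mem_filter.2 ⟨hk, le_rfl⟩
      rcases Nat.eq_zero_or_pos k.1 with ha | ha
      · rw [ha, hf.center _ h0T] at ht1
        obtain rfl := Option.some_injective _ ht1
        rw [hself, zero_add]
        refine ENNReal.ofReal_le_ofReal ?_
        have h1 : W k.2.1 ≤ ∑ k' ∈ K.filter (fun k' => k'.2.2 ≤ k.2.2), W k'.2.1 :=
          Finset.single_le_sum (f := fun k : ℕ × ℕ × ℕ => W k.2.1) (fun i _ => hW0 _) hmem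
        rw [ha, hd.self] at hkt
        have : R * W k.2.1 ≤ R * ∑ k' ∈ K.filter (fun k' => k'.2.2 ≤ k.2.2), W k'.2.1 :=
          mul_le_mul_of_nonneg_left h1 hR0
        linarith
      -- With no active positions left, the disjoint detours tile the geodesic, so the preceding one
      -- ends exactly one position before `k` starts.
      · obtain ⟨k', hk', hk1, hk2⟩ := h.cover (k.1 - 1) (by omega) (by simp)
        have hne : k ≠ k' := by rintro rfl; omega
        have hdis := h.disjoint k hk k' hk' hne
        have hb' : k'.2.2 = k.1 - 1 := by omega
        obtain ⟨s, -, hs⟩ := h.same k' hk'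
        rw [hb'] at hs
        have hi := ih (k.1 - 1) (by omega) k' hk' hb' s hs
        set a := k.1 - 1 with ha'
        have hka : k.1 = a + 1 := by omega
        rw [hka] at ht1 hkt
        have hG := hp.adj a (by omega)
        have hhop := hadj _ _ _ _ hG hs ht1
        have hdist : d s t' ≤ d (p a) s + (d (p 0) (p (a + 1)) - d (p 0) (p a)) +
            d (p (a + 1)) t' := by
          have h1 := hd.triangle s (p a) t'
          have h2 := hd.triangle (p a) (p (a + 1)) t'
          rw [hp.additive a (a + 1) (by omega) (by omega)] at h2
          rw [hd.symm s (p a)] at h1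
          linarith
        have hx : 0 ≤ d (p 0) (p (a + 1)) - d (p 0) (p a) := by
          rw [← hp.additive a (a + 1) (by omega) (by omega)]; exact hd.nonneg _ _
        have hsum : ∑ k' ∈ K.filter (fun k' => k'.2.2 ≤ a), W k'.2.1 + W k.2.1 ≤
            ∑ k' ∈ K.filter (fun k' => k'.2.2 ≤ k.2.2), W k'.2.1 := by
          rw [add_comm, ← Finset.sum_insert (a := k) (f := fun k : ℕ × ℕ × ℕ => W k.2.1)
            (by simp; omega)]
          refine Finset.sum_le_sum_of_subset_of_nonneg ?_ fun i _ _ => hW0 _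
          intro i hi
          rcases Finset.mem_insert.1 hi with rfl | hi
          · exact hmem
          · rw [Finset.mem_filter] at hi ⊢
            exact ⟨hi.1, by omega⟩
        have n1 := hd.nonneg (p a) s
        have n2 := hd.nonneg (p (a + 1)) t'
        have n3 := hd.nonneg (p k.2.2) t'
        have n4 : 0 ≤ R * (4 * ∑ k' ∈ K.filter (fun k' => k'.2.2 ≤ a), W k'.2.1 +
            d (p 0) (p a)) := mul_nonneg hR0 (add_nonneg (mul_nonneg (by norm_num)
              (Finset.sum_nonneg fun i _ => hW0 _)) (hd.nonneg _ _))
        calc dH (p 0) t' + ENNReal.ofReal (d (p k.2.2) t')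
            ≤ (dH (p 0) s + ENNReal.ofReal (d (p a) s + (d (p 0) (p (a + 1)) - d (p 0) (p a)) +
              d (p (a + 1)) t')) + ENNReal.ofReal (d (p k.2.2) t') := by
              gcongr
              exact (htri _ s _).trans (add_le_add le_rfl
                (hhop.trans (ENNReal.ofReal_le_ofReal hdist)))
          _ = (dH (p 0) s + ENNReal.ofReal (d (p a) s)) +
              ENNReal.ofReal ((d (p 0) (p (a + 1)) - d (p 0) (p a)) +
                (d (p (a + 1)) t' + d (p k.2.2) t')) := by
              rw [add_assoc (d (p a) s), ENNReal.ofReal_add n1 (add_nonneg hx n2),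
                ← add_assoc (d (p 0) (p (a + 1)) - d (p 0) (p a)),
                ENNReal.ofReal_add (add_nonneg hx n2) n3]
              ring
          _ ≤ ENNReal.ofReal (R * (4 * ∑ k' ∈ K.filter (fun k' => k'.2.2 ≤ a), W k'.2.1 +
              d (p 0) (p a))) + ENNReal.ofReal ((d (p 0) (p (a + 1)) - d (p 0) (p a)) +
                (d (p (a + 1)) t' + d (p k.2.2) t')) := add_le_add hi le_rfl
          _ ≤ _ := by
              rw [← ENNReal.ofReal_add n4 (add_nonneg hx (add_nonneg n2 n3))]
              refine ENNReal.ofReal_le_ofReal ?_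
              nlinarith
  obtain ⟨k, hk, hk1, hk2⟩ := h.cover n le_rfl (by simp)
  have hkn : k.2.2 = n := le_antisymm (h.le k hk).2.2 hk2
  have := key n k hk hkn (p n) (hf.center _ hnT)
  refine le_self_add.trans (this.trans (ENNReal.ofReal_le_ofReal ?_))
  have hs : ∑ k' ∈ K.filter (fun k' => k'.2.2 ≤ n), W k'.2.1 ≤ ∑ k' ∈ K, W k'.2.1 :=
    Finset.sum_le_sum_of_subset_of_nonneg (Finset.filter_subset _ _) fun i _ _ => hW0 _
  gcongr

end Chain

/-! ### Inherited edge lengths, choice of parameters, assembly. -/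

section Minor

universe u
variable {V : Type u}

/-- The edge lengths of a minor which are given by the distances in the original graph. -/
noncomputable def inheritedLength (G : SimpleGraph V) (w : Sym2 V → ℝ≥0) (H : GraphIn V) :
    Sym2 H.verts → ℝ≥0 :=
  Sym2.lift ⟨fun a b => (wdist G w a b).toNNReal, fun _ _ =>
    congrArg ENNReal.toNNReal (wdist_comm w _ _)⟩

theorem wdist_le_wdist_inheritedLength {G : SimpleGraph V} (hG : G.Connected) (w : Sym2 V → ℝ≥0)
    (H : GraphIn V) (s t : H.verts) :
    wdist G w s t ≤ wdist H.coe (inheritedLength G w H) s t := by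
  refine le_wdist fun p => ?_
  induction p with
  | nil => simp [wdist_self]
  | @cons a b c h q ih =>
    rw [walkLength_cons, ENNReal.coe_add]
    refine (wdist_triangle w _ (b : V) _).trans (add_le_add ?_ ih)
    simp only [inheritedLength, Sym2.lift_mk]
    rw [ENNReal.coe_toNNReal (wdist_ne_top hG _ _ _)]

/-- The distortion that the construction achieves with `k` terminals. -/
noncomputable def distortion (k : ℕ) : ℝ := 20000 + 7000 * Real.log k

theorem exists_parameters {k : ℕ} (hk : 2 ≤ k) : ∃ m : ℕ, 1 ≤ m ∧
    (1 + Real.exp 3 * (31 / 32) ^ m) ^ k * ((k : ℝ) ^ 2 * Real.exp (16 / (1 / (m : ℝ)))) ≤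
      Real.exp (1 + 2 * Real.log k + 16 * m) ∧
    (1 + 1 / (m : ℝ)) ^ m * (4 * (1 + 2 * Real.log k + 16 * m) + 1) ≤ distortion k := by
  have hk0 : (0 : ℝ) < k := by positivity
  have hl : 0 ≤ Real.log k := Real.log_natCast_nonneg k
  -- This `m` makes the truncation error at most `1 / k` per terminal, hence a factor at most `exp
  -- 1` over all `k` terminals.
  refine ⟨⌈32 * (Real.log k + 3)⌉₊, Nat.one_le_ceil_iff.2 (by positivity), ?_, ?_⟩
  · set m := ⌈32 * (Real.log k + 3)⌉₊ with hm
    have hm1 : 32 * (Real.log k + 3) ≤ m := Nat.le_ceil _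
    have h1 : Real.exp 3 * (31 / 32 : ℝ) ^ m ≤ 1 / k := by
      have h2 : (31 / 32 : ℝ) ≤ Real.exp (-(1 / 32)) := by
        have := Real.add_one_le_exp (-(1 / 32) : ℝ)
        linarith
      calc Real.exp 3 * (31 / 32 : ℝ) ^ m ≤ Real.exp 3 * Real.exp (-(1 / 32)) ^ m := by gcongr
        _ = Real.exp (3 + m * (-(1 / 32))) := by rw [← Real.exp_nat_mul, ← Real.exp_add]
        _ ≤ Real.exp (-Real.log k) := Real.exp_le_exp.2 (by linarith)
        _ = 1 / k := by rw [Real.exp_neg, Real.exp_log hk0, one_div]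
    have h3 : (1 + Real.exp 3 * (31 / 32 : ℝ) ^ m) ^ k ≤ Real.exp 1 := by
      calc (1 + Real.exp 3 * (31 / 32 : ℝ) ^ m) ^ k ≤ Real.exp (1 / k) ^ k := by
            gcongr
            have := Real.add_one_le_exp (1 / k : ℝ)
            linarith
        _ = Real.exp 1 := by rw [← Real.exp_nat_mul, mul_one_div_cancel hk0.ne']
    have h4 : (k : ℝ) ^ 2 = Real.exp (2 * Real.log k) := by
      rw [← Real.exp_log hk0, ← Real.exp_nat_mul, Real.log_exp]; norm_num
    rw [h4, Real.exp_add, Real.exp_add, mul_assoc]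
    have h5 : (16 : ℝ) / (1 / m) = 16 * m := by rw [div_div_eq_mul_div, div_one]
    rw [h5]
    gcongr
  · set m := ⌈32 * (Real.log k + 3)⌉₊ with hm
    have hm1 : (m : ℝ) < 32 * (Real.log k + 3) + 1 := Nat.ceil_lt_add_one (by positivity)
    have hm0 : (0 : ℝ) < m := by
      exact_mod_cast Nat.lt_of_lt_of_le Nat.zero_lt_one (Nat.one_le_ceil_iff.2 (by positivity))
    have h1 : (1 + 1 / (m : ℝ)) ^ m ≤ 3 := by
      calc (1 + 1 / (m : ℝ)) ^ m ≤ Real.exp (1 / m) ^ m := by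
            gcongr
            have := Real.add_one_le_exp (1 / m : ℝ)
            linarith
        _ = Real.exp 1 := by rw [← Real.exp_nat_mul, mul_one_div_cancel hm0.ne']
        _ ≤ 3 := Real.exp_one_lt_d9.le.trans (by norm_num)
    calc _ ≤ 3 * (4 * (1 + 2 * Real.log k + 16 * m) + 1) := by gcongr
      _ ≤ _ := by unfold distortion; linarith

theorem distortion_le {k : ℕ} (hk : 2 ≤ k) : distortion k ≤ 2 * 10 ^ 8 * Real.log k ^ 2 := by
  have h : 1 / 2 ≤ Real.log k :=
    (by norm_num : (1 / 2 : ℝ) ≤ 0.6931471803).trans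
      (Real.log_two_gt_d9.le.trans (Real.log_le_log (by norm_num) (by exact_mod_cast hk)))
  unfold distortion
  nlinarith

/-- Total clusterings of a graph with positive edge lengths in which the terminals are close to
each other. -/
theorem exists_total_clustering [Finite V] {G : SimpleGraph V} {d : V → V → ℝ}
    (hd : IsGeodesicMetric G d) {T : Finset V} (hT : 2 ≤ T.card) :
    ∃ f : V → V, (∀ v, f v ∈ T) ∧ (∀ t ∈ T, f t = t) ∧
      (∀ x, Relation.ReflTransGen (fun a b => G.Adj a b ∧ f b = f x) (f x) x) ∧
      ∀ dH : V → V → ℝ≥0∞, (∀ t, dH t t = 0) → (∀ r s t, dH r t ≤ dH r s + dH s t) →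
        (∀ x y, G.Adj x y → dH (f x) (f y) ≤ ENNReal.ofReal (d (f x) (f y))) →
        ∀ s ∈ T, ∀ t ∈ T, dH s t ≤ ENNReal.ofReal (distortion T.card * d s t) := by
  classical
  obtain ⟨D, hD⟩ := exists_isDistTo (T := T) (Finset.card_pos.1 (by omega)) d
  obtain ⟨m, hm, hpot, hκ⟩ := exists_parameters hT
  have hm' : (1 : ℝ) ≤ m := by exact_mod_cast hm
  have hδ : 0 < 1 / (m : ℝ) := by positivity
  have hδ1 : 1 / (m : ℝ) ≤ 1 := by rw [div_le_one (by positivity)]; exact hm'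
  let ι := {x : T × T // x.1 ≠ x.2}
  have hpath := fun i : ι => hd.geodesic i.1.1 i.1.2
  choose n p hp0 hpn hadj hadd using hpath
  have hp : ∀ i, IsGeodesic G d (n i) (p i) := fun i =>
    ⟨hadj i, fun a b hab hb => by rw [hp0]; exact hadd i a b hab hb⟩
  have h0T : ∀ i, p i 0 ∈ T := fun i => by rw [hp0]; exact i.1.1.2
  have hnT : ∀ i, p i (n i) ∈ T := fun i => by rw [hpn]; exact i.1.2.2
  have hne : ∀ i, p i 0 ≠ p i (n i) := fun i => by
    rw [hp0, hpn]; exact fun h => i.2 (Subtype.ext h)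
  obtain ⟨f, hf, A, K, htr, hsum⟩ := exists_clustering hd hD hδ hδ1 m n p hp h0T hnT hne T
    subset_rfl
  have hnone := hf.ne_none hd hD
  choose F hF using fun v => Option.ne_none_iff_exists'.1 (hnone v)
  have hA : ∀ i, A i = ∅ := fun i => Finset.eq_empty_of_forall_notMem fun j hj =>
    hnone _ ((htr i).active j hj).2
  have hFT : ∀ t ∈ T, F t = t := fun t ht =>
    Option.some_injective _ ((hF t).symm.trans (hf.center t ht))
  refine ⟨F, fun v => hf.mem v _ (hF v), hFT, fun x => Relation.ReflTransGen.mono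
    (fun a b h => ⟨h.1, Option.some_injective _ ((hF b).symm.trans h.2)⟩) _ _
    (hf.connected x _ (hF x)), ?_⟩
  intro dH hself htri hHadj s hs t ht
  rcases eq_or_ne s t with rfl | hst
  · rw [hself]; exact bot_le
  let i : ι := ⟨(⟨s, hs⟩, ⟨t, ht⟩), fun h => hst (congrArg Subtype.val h)⟩
  have hL : 0 < d s t := hd.pos s t hst
  have hps : p i 0 = s := hp0 i
  have hpt : p i (n i) = t := hpn i
  have hcard : (Fintype.card ι : ℝ) ≤ (T.card : ℝ) ^ 2 := by
    have := Fintype.card_subtype_le fun x : T × T => x.1 ≠ x.2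
    rw [Fintype.card_prod, Fintype.card_coe, ← sq] at this
    exact_mod_cast this
  have hW0 : ∀ j, 0 ≤ D (p i (leader d D (1 / (m : ℝ) / 8) (p i) j)) := fun j => hD.nonneg hd _
  have hle : ∑ k ∈ K i, D (p i (leader d D (1 / (m : ℝ) / 8) (p i) k.2.1)) ≤
      (1 + 2 * Real.log T.card + 16 * m) * d s t := by
    have h1 := (Finset.single_le_sum (f := fun i => Real.exp ((d (p i 0) (p i (n i)))⁻¹ *
      potential (fun j => leader d D (1 / (m : ℝ) / 8) (p i) j = j)
        (fun j => D (p i (leader d D (1 / (m : ℝ) / 8) (p i) j))) (A i) (K i)))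
        (fun _ _ => (Real.exp_pos _).le) (Finset.mem_univ i)).trans hsum
    -- One summand is at most the whole sum; taking logarithms bounds the potential, which consists
    -- of detours alone because no position is active.
    have h2 := h1.trans ((mul_le_mul_of_nonneg_left
      (mul_le_mul_of_nonneg_right hcard (Real.exp_pos _).le) (by positivity)).trans hpot)
    rw [Real.exp_le_exp, hps, hpt, inv_mul_le_iff₀ hL, hA i] at h2
    simp only [potential, sliceWeight, starts, Finset.filter_empty, Finset.sum_empty, mul_zero,
      add_zero] at h2
    linarith
  have hchain := (hA i ▸ htr i : Tracks f (n i) (p i) ∅ (K i)).chain_le hd hD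
    (one_le_pow₀ (by linarith) : 1 ≤ (1 + 1 / (m : ℝ)) ^ m) hf (hp i) (hnT i) (h0T i) hW0
    (fun j => by
      have h1 := dist_leader_le hd hD (by positivity : 0 ≤ 1 / (m : ℝ) / 8) (p i) j
      have h2 := hD.le_add hd (p i j) (p i (leader d D (1 / (m : ℝ) / 8) (p i) j))
      rw [hd.symm] at h2
      have h3 := hW0 j
      nlinarith) dH hself htri
    (fun x y a b hxy ha hb => by
      have := hHadj x y hxy
      rwa [Option.some_injective _ ((hF x).symm.trans ha),
        Option.some_injective _ ((hF y).symm.trans hb)] at this)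
  rw [hps, hpt] at hchain
  refine hchain.trans (ENNReal.ofReal_le_ofReal ?_)
  calc _ ≤ (1 + 1 / (m : ℝ)) ^ m * (4 * ((1 + 2 * Real.log T.card + 16 * m) * d s t) + d s t) := by
        gcongr
    _ = (1 + 1 / (m : ℝ)) ^ m * (4 * (1 + 2 * Real.log T.card + 16 * m) + 1) * d s t := by ring
    _ ≤ _ := by gcongr

theorem exists_minor_of_pos [Finite V] {G : SimpleGraph V} (hG : G.Connected) (w : Sym2 V → ℝ≥0)
    (hw : ∀ e, 0 < w e) {T : Finset V} (hT : 2 ≤ T.card) :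
    ∃ H : GraphIn V, IsMinor H G ∧ H.verts = (T : Set V) ∧ ∀ s t : H.verts,
      wdist H.coe (inheritedLength G w H) s t ≤
        ENNReal.ofReal (distortion T.card) * wdist G w s t := by
  obtain ⟨f, hfT, hfix, hconn, hdist⟩ :=
    exists_total_clustering (isGeodesicMetric_wdist hG w hw) hT
  have hff : ∀ x, f (f x) = f x := fun x => hfix _ (hfT x)
  have hverts : (imageGraph G f).verts = (T : Set V) := by
    ext x
    exact ⟨fun ⟨y, hy⟩ => hy ▸ hfT y, fun hx => ⟨x, hfix x hx⟩⟩
  refine ⟨imageGraph G f, isMinor_imageGraph G f hff hconn, hverts, ?_⟩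
  let π : V → (imageGraph G f).verts := fun x => ⟨f x, x, rfl⟩
  have hmem : ∀ s : (imageGraph G f).verts, (s : V) ∈ T := fun s => by
    rw [← Finset.mem_coe, ← hverts]; exact s.2
  have hπ : ∀ s : (imageGraph G f).verts, π s = s := fun s =>
    Subtype.ext (hfix s (hmem s))
  intro s t
  -- Pulling the distance of the minor back along the contraction gives a pseudometric on all of
  -- `V`, as the clustering bound expects.
  have h := hdist (fun a b => wdist (imageGraph G f).coe (inheritedLength G w _) (π a) (π b))
    (fun _ => wdist_self _ _) (fun _ _ _ => wdist_triangle _ _ _ _) ?_ s (hmem s) t (hmem t)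
  · simp only [hπ] at h
    refine h.trans_eq ?_
    rw [ENNReal.ofReal_mul (by
      have := Real.log_natCast_nonneg T.card
      unfold distortion; linarith), ENNReal.ofReal_toReal (wdist_ne_top hG _ _ _)]
  · intro x y hxy
    have e : ∀ x, π (f x) = π x := fun x => Subtype.ext (hff x)
    simp only [e]
    rcases eq_or_ne (f x) (f y) with hxy' | hxy'
    · rw [show π x = π y from Subtype.ext hxy', wdist_self]
      exact bot_le
    · have hadj : (imageGraph G f).coe.Adj (π x) (π y) := ⟨hxy', x, y, hxy, rfl, rfl⟩
      refine (wdist_le_of_adj _ hadj).trans ?_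
      simp only [inheritedLength, Sym2.lift_mk]
      rw [ENNReal.coe_toNNReal (wdist_ne_top hG _ _ _), ENNReal.ofReal_toReal (wdist_ne_top hG _ _ _)]

theorem walkLength_add_const {G : SimpleGraph V} (w : Sym2 V → ℝ≥0) (c : ℝ≥0) {u v : V}
    (q : G.Walk u v) :
    walkLength (fun e => w e + c) q = walkLength w q + q.length * c := by
  induction q with
  | nil => simp [walkLength_nil]
  | cons h q ih =>
    rw [walkLength_cons, walkLength_cons, ih, SimpleGraph.Walk.length_cons]
    push_cast
    ring

/-- Add `1 / (n + 1)` to all lengths. Only finitely many minors exist, so one of them serves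
infinitely many `n`, and its bound passes to the limit. -/
theorem exists_minor [Finite V] {G : SimpleGraph V} (hG : G.Connected) (w : Sym2 V → ℝ≥0)
    {T : Finset V} (hT : 2 ≤ T.card) :
    ∃ H : GraphIn V, IsMinor H G ∧ H.verts = (T : Set V) ∧ ∀ s t : H.verts,
      wdist H.coe (inheritedLength G w H) s t ≤
        ENNReal.ofReal (distortion T.card) * wdist G w s t := by
  let w' : ℕ → Sym2 V → ℝ≥0 := fun n e => w e + 1 / (n + 1)
  have hww' : ∀ n, w ≤ w' n := fun n e => le_self_add
  choose Hn hmin hverts hdist using fun n =>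
    exists_minor_of_pos hG (w' n) (fun e => add_pos_of_nonneg_of_pos zero_le (by positivity)) hT
  have : Finite (GraphIn V) := by
    have : Function.Injective fun H : GraphIn V => (H.verts, H.Adj) := fun H H' h => by
      simp only [Prod.mk.injEq] at h
      exact SimpleGraph.Subgraph.ext h.1 h.2
    exact Finite.of_injective _ this
  obtain ⟨H, hH⟩ := Finite.exists_infinite_fiber Hn
  have hinf : {n | Hn n = H}.Infinite := Set.infinite_coe_iff.1 hH
  obtain ⟨n₀, hn₀⟩ := hinf.nonempty
  refine ⟨H, hn₀ ▸ hmin n₀, hn₀ ▸ hverts n₀, fun s t => ?_⟩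
  obtain ⟨q, hq⟩ := exists_walkLength_eq_wdist hG w s t
  have hbound : ∀ n, Hn n = H → wdist H.coe (inheritedLength G w H) s t ≤
      ENNReal.ofReal (distortion T.card) *
        ((walkLength w q + q.length * (1 / (n + 1)) : ℝ≥0) : ℝ≥0∞) := by
    rintro n rfl
    rw [← walkLength_add_const]
    refine (wdist_mono ?_ s t).trans ((hdist n s t).trans
      (mul_le_mul_right (wdist_le (w' n) q) _))
    intro e
    induction e with
    | _ a b =>
      simp only [inheritedLength, Sym2.lift_mk]
      exact ENNReal.toNNReal_mono (wdist_ne_top hG _ _ _) (wdist_mono (hww' n) _ _)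
  have hlim : Filter.Tendsto (fun n : ℕ => ENNReal.ofReal (distortion T.card) *
        ((walkLength w q + q.length * (1 / ((n : ℝ≥0) + 1)) : ℝ≥0) : ℝ≥0∞)) Filter.atTop
      (nhds (ENNReal.ofReal (distortion T.card) * ((walkLength w q : ℝ≥0) : ℝ≥0∞))) := by
    refine ENNReal.Tendsto.const_mul ?_ (Or.inr ENNReal.ofReal_ne_top)
    rw [ENNReal.tendsto_coe]
    have h := (tendsto_one_div_add_atTop_nhds_zero_nat (𝕜 := ℝ≥0)).const_mul (q.length : ℝ≥0)
    simpa using h.const_add (walkLength w q)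
  rw [hq]
  exact ge_of_tendsto_of_frequently hlim
    ((Nat.frequently_atTop_iff_infinite.2 hinf).mono fun n hn => hbound n hn)

theorem reflTransGen_adj {G : SimpleGraph V} (hG : G.Connected) (u v : V) :
    Relation.ReflTransGen G.Adj u v :=
  (SimpleGraph.reachable_iff_reflTransGen u v).1 (hG.preconnected u v)

theorem isMinor_imageGraph_const [Finite V] {G : SimpleGraph V} (hG : G.Connected) (v : V) :
    IsMinor (imageGraph G fun _ => v) G :=
  isMinor_imageGraph G _ (fun _ => rfl) fun x =>
    Relation.ReflTransGen.mono (fun _ _ h => ⟨h, rfl⟩) _ _ (reflTransGen_adj hG v x)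

theorem solvableWithDistortion [Finite V] (G : SimpleGraph V) (w : Sym2 V → ℝ≥0) (T : Finset V)
    (hG : G.Connected) :
    SolvableWithDistortion G w T (2 * 10 ^ 8 * Real.log (T.card : ℝ) ^ 2) := by
  rcases Nat.lt_or_ge T.card 2 with hT | hT
  · obtain ⟨v⟩ := hG.nonempty
    obtain ⟨H, hH, hv⟩ : ∃ H : GraphIn V, IsMinor H G ∧ H.verts = (T : Set V) := by
      rcases Nat.lt_or_ge T.card 1 with h0 | h1
      -- Without terminals, contract everything to one vertex and delete it.
      · refine ⟨_, (isMinor_imageGraph_const hG v).tail (.deleteVertex _ v ⟨v, rfl⟩), ?_⟩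
        rw [Finset.card_eq_zero.1 (by omega : T.card = 0)]
        ext x
        simp [imageGraph, eq_comm]
      · obtain ⟨t, rfl⟩ := Finset.card_eq_one.1 (by omega : T.card = 1)
        refine ⟨_, isMinor_imageGraph_const hG t, ?_⟩
        have := hG.nonempty
        simp [imageGraph]
    refine ⟨H, hH, hv, inheritedLength G w H, fun s t =>
      ⟨wdist_le_wdist_inheritedLength hG w H s t, ?_⟩⟩
    have hst : s = t := Subtype.ext (Finset.card_le_one.1 (by omega : T.card ≤ 1) _
      (by rw [← Finset.mem_coe, ← hv]; exact s.2) _ (by rw [← Finset.mem_coe, ← hv]; exact t.2))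
    rw [hst, wdist_self]
    exact bot_le
  · obtain ⟨H, hH, hv, hdist⟩ := exists_minor hG w hT
    exact ⟨H, hH, hv, inheritedLength G w H, fun s t =>
      ⟨wdist_le_wdist_inheritedLength hG w H s t, (hdist s t).trans
        (mul_le_mul_left (ENNReal.ofReal_le_ofReal (distortion_le hT)) _)⟩⟩

end Minor

end SteinerPointRemoval

theorem theorem1 :
    (∃ C : ℝ, ∀ (V : Type*) [Finite V] (G : SimpleGraph V) (w : Sym2 V → ℝ≥0) (T : Finset V),
      G.Connected →
        SteinerPointRemoval.SolvableWithDistortion G w T (C * Real.log (T.card : ℝ) ^ 2)) ∧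
    (∃ k₀ : ℕ, ∀ (V : Type*) [Finite V] (G : SimpleGraph V) (w : Sym2 V → ℝ≥0) (T : Finset V),
      G.Connected → k₀ ≤ T.card →
        SteinerPointRemoval.SolvableWithDistortion G w T
          (2 * 10 ^ 8 * Real.log (T.card : ℝ) ^ 2)) := by
  exact ⟨⟨2 * 10 ^ 8, fun V _ G w T hG => SteinerPointRemoval.solvableWithDistortion G w T hG⟩,
    0, fun V _ G w T hG _ => SteinerPointRemoval.solvableWithDistortion G w T hG⟩
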